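/- Let $k=(k_1,k_2)\in\mathbb R^2$ with $k_2>-\tfrac12$ and $k_1+k_2>-\tfrac12$ (in particular, any $k_1,k_2\ge 0$ is allowed). Put $\rho(k)=\tfrac12(k_1+2k_2)$, $k_+=k+(1,0)$, $k_-=k+(-1,1)$, and for $x\in(-1,1)$ $$w_k(x)=2^{k_1+2k_2}(1-x)^{k_1+k_2-\frac12}(1+x)^{k_2-\frac12},\qquad \mathcal W_k(x)=w_k(x)\begin{pmatrix}1&x\\x&1\end{pmatrix},\qquad U=\tfrac1{\sqrt2}\begin{pmatrix}1&-1\\1&1\end{pmatrix}.$$ Let $\mathbb M_2=\mathbb C^{2\times 2}$ and let $\mathbb A_2=\mathbb C[x,\partial_x]\otimes\mathbb M_2$ be the algebra of $2\times2$ matrix differential operators with polynomial coefficients, acting from the left on $\mathbb M_2[x]$. For a matrix weight $\mathcal W$ on $[-1,1]$, a family of matrix-valued orthogonal polynomials for $\mathcal W$ is a sequence $(\mathcal Q_n)_{n\ge0}$ in $\mathbb M_2[x]$ such that $\mathcal Q_n$ has degree $n$ with invertible leading coefficient and $\int_{-1}^1\mathcal Q_m(x)^*\mathcal W(x)\mathcal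 Q_n(x)\,dx=0$ for $m\neq n$. For such a family put $$\mathcal D(\mathcal W)=\{D\in\mathbb A_2 : \text{for every } n\ge0 \text{ there is } \Lambda_n(D)\in\mathbb M_2 \text{ with } D\mathcal Q_n=\mathcal Q_n\Lambda_n(D)\}.$$ Let $$S=\begin{pmatrix}0&1\\1&0\end{pmatrix},\quad S'=\begin{pmatrix}1&0\\0&-1\end{pmatrix},\quad \mathcal D_k=\begin{pmatrix}-x&-1\\1&x\end{pmatrix}\partial_x+\begin{pmatrix}-\rho(k)&k_1\\0&1+\rho(k)\end{pmatrix},\quad \mathfrak D_k=U\mathcal D_kU^{-1}.$$ Then families of matrix-valued orthogonal polynomials exist for $\mathcal W_k$ and for $\mathrm{diag}(w_{k_+},w_{k_-})$, and, for any choice of these families, the following hold. 1. The algebra $\mathcal D(\mathcal W_k)$ is generated by $I$, $S$ and $\mathcal D_k$. 2. With $\mathcal D(\mathcal W_k)^{(N)}$ the space of elements of $\mathcal D(\mathcal W_k)$ of order at most $N$, and $\mathcal D(\mathcal W_k)^{(-1)}=0$, the quotient $\mathcal D(\mathcal W_k)^{(N)}/\mathcal D(\mathcal W_k)^{(N-1)}$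 is a two-dimensional complex vector space for every $N\ge0$. 3. The algebra $\mathcal D(\mathrm{diag}(w_{k_+},w_{k_-}))$ is generated by $I$, $S'$ and $\mathfrak D_k$. 4. An operator $D\in\mathbb A_2$ lies in $\mathcal D(\mathcal W_k)$ if and only if $UDU^{-1}$ lies in $\mathcal D(\mathrm{diag}(w_{k_+},w_{k_-}))$. -/

import Mathlib

open Polynomial

noncomputable section

namespace JacobiDW

/-- The Weyl algebra `ℂ[x, ∂ₓ]`, realised (faithfully) by its action on `ℂ[x]`. -/
def Weyl : Subalgebra ℂ (Module.End ℂ ℂ[X]) :=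
  Algebra.adjoin ℂ {LinearMap.mulLeft ℂ (X : ℂ[X]), Polynomial.derivative}

instance : Ring Weyl := Subalgebra.toRing Weyl

/-- Multiplication by `x`. -/
def wX : Weyl := ⟨LinearMap.mulLeft ℂ (X : ℂ[X]), Algebra.subset_adjoin (by simp)⟩

/-- Differentiation `∂ₓ`. -/
def wD : Weyl := ⟨Polynomial.derivative, Algebra.subset_adjoin (by simp)⟩

/-- The algebra `𝔸₂ = ℂ[x, ∂ₓ] ⊗ 𝕄₂` of matrix differential operators. -/
abbrev A2 : Type := Matrix (Fin 2) (Fin 2) Weyl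

/-- The space `𝕄₂[x]` of matrix-valued polynomials. -/
abbrev M2X : Type := Matrix (Fin 2) (Fin 2) ℂ[X]

/-- A constant matrix as a (constant) matrix-valued polynomial. -/
def polyConst (A : Matrix (Fin 2) (Fin 2) ℂ) : M2X := A.map Polynomial.C

/-- A constant matrix as a differential operator of order zero. -/
def opConst (A : Matrix (Fin 2) (Fin 2) ℂ) : A2 := A.map (algebraMap ℂ Weyl)

/-- The action of `𝔸₂` on `𝕄₂[x]` from the left. -/
def act (D : A2) (P : M2X) : M2X :=
  Matrix.of fun i j => ∑ l, (D i l : Module.End ℂ ℂ[X]) (P l j)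

/-- The value of a matrix-valued polynomial at a real point. -/
def evalAt (P : M2X) (x : ℝ) : Matrix (Fin 2) (Fin 2) ℂ := P.map (Polynomial.eval (x : ℂ))

/-- The matrix-valued pairing `∫_{-1}^1 P(x)^* W(x) Q(x) dx`, integrated entry by entry. -/
def pairing (W : ℝ → Matrix (Fin 2) (Fin 2) ℂ) (P Q : M2X) : Matrix (Fin 2) (Fin 2) ℂ :=
  Matrix.of fun i j =>
    ∫ x in (-1 : ℝ)..1, ((evalAt P x).conjTranspose * W x * evalAt Q x) i j

/-- `(Q n)` is a family of matrix-valued orthogonal polynomials for the matrix weight `W` on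
`[-1, 1]`: `Q n` has degree `n` with invertible leading coefficient, and distinct members are
orthogonal. -/
structure IsMOP (W : ℝ → Matrix (Fin 2) (Fin 2) ℂ) (Q : ℕ → M2X) : Prop where
  degree_le : ∀ n i j, (Q n i j).natDegree ≤ n
  isUnit_lead : ∀ n, IsUnit ((Q n).map fun p => p.coeff n)
  orthogonal : ∀ m n, m ≠ n → pairing W (Q m) (Q n) = 0

lemma act_mul (D E : A2) (P : M2X) : act (D * E) P = act D (act E P) := by
  ext1 i j
  simp [act, Matrix.mul_apply, Fin.sum_univ_two]
  ring

lemma act_add (D E : A2) (P : M2X) : act (D + E) P = act D P + act E P := by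
  ext1 i j
  simp [act, Fin.sum_univ_two]
  ring

lemma act_algebraMap (c : ℂ) (P : M2X) :
    act (algebraMap ℂ A2 c) P = P * polyConst (algebraMap ℂ _ c) := by
  ext1 i j
  fin_cases i <;> fin_cases j <;>
    simp [act, polyConst, Matrix.mul_apply, Matrix.algebraMap_matrix_apply, Fin.sum_univ_two,
      Module.algebraMap_end_apply, Polynomial.smul_eq_C_mul, mul_comm]

lemma act_mul_polyConst (D : A2) (P : M2X) (A : Matrix (Fin 2) (Fin 2) ℂ) :
    act D (P * polyConst A) = act D P * polyConst A := by
  have h : ∀ (T : Module.End ℂ ℂ[X]) (p : ℂ[X]) (c : ℂ), T (p * C c) = T p * C c := by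
    intro T p c
    rw [mul_comm, ← Polynomial.smul_eq_C_mul, map_smul, Polynomial.smul_eq_C_mul, mul_comm]
  ext1 i j
  simp [act, polyConst, Matrix.mul_apply, Fin.sum_univ_two, h]
  ring

lemma polyConst_mul (A B : Matrix (Fin 2) (Fin 2) ℂ) :
    polyConst (A * B) = polyConst A * polyConst B := by
  ext1 i j
  simp [polyConst, Matrix.mul_apply]

lemma polyConst_add (A B : Matrix (Fin 2) (Fin 2) ℂ) :
    polyConst (A + B) = polyConst A + polyConst B := by
  ext1 i j
  simp [polyConst]

/-- The algebra of all `D ∈ 𝔸₂` with `D Qₙ = Qₙ Λₙ(D)` for constant matrices `Λₙ(D)`, `n ≥ 0`.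
If `(Qₙ)` is a family of orthogonal polynomials for `W`, this is the algebra `𝒟(W)`. -/
def eigenAlgebra (Q : ℕ → M2X) : Subalgebra ℂ A2 where
  carrier := {D | ∀ n, ∃ L : Matrix (Fin 2) (Fin 2) ℂ, act D (Q n) = Q n * polyConst L}
  mul_mem' := by
    intro D E hD hE n
    obtain ⟨L, hL⟩ := hD n
    obtain ⟨M, hM⟩ := hE n
    exact ⟨L * M, by rw [act_mul, hM, act_mul_polyConst, hL, polyConst_mul, mul_assoc]⟩
  add_mem' := by
    intro D E hD hE n
    obtain ⟨L, hL⟩ := hD n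
    obtain ⟨M, hM⟩ := hE n
    exact ⟨L + M, by rw [act_add, hL, hM, polyConst_add, mul_add]⟩
  algebraMap_mem' := fun c n => ⟨_, act_algebraMap c (Q n)⟩

/-- The matrix differential operators of order `< N`: every entry has the form
`∑_{j < N} a_j(x) ∂ₓ^j` with polynomials `a_j`. For `N = 0` this is the zero space. -/
def ordLT (N : ℕ) : Submodule ℂ A2 where
  carrier := {D | ∀ i j, ∃ a : ℕ → ℂ[X], ∀ f : ℂ[X],
    (D i j : Module.End ℂ ℂ[X]) f =
      ∑ m ∈ Finset.range N, a m * Polynomial.derivative^[m] f}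
  add_mem' := by
    intro D E hD hE i j
    obtain ⟨a, ha⟩ := hD i j
    obtain ⟨b, hb⟩ := hE i j
    exact ⟨a + b, fun f => by simp [ha, hb, add_mul, Finset.sum_add_distrib]⟩
  zero_mem' := fun i j => ⟨0, fun f => by simp⟩
  smul_mem' := by
    intro c D hD i j
    obtain ⟨a, ha⟩ := hD i j
    exact ⟨fun m => c • a m, fun f => by simp [ha, Finset.smul_sum]⟩

/-- The part of order `< N` of a subalgebra `B` of `𝔸₂`. Thus `filt B (N + 1)` is the space
`B^(N)` of elements of order at most `N`, and `filt B 0 = 0` is `B^(-1)`. -/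
def filt (B : Subalgebra ℂ A2) (N : ℕ) : Submodule ℂ A2 :=
  Subalgebra.toSubmodule B ⊓ ordLT N

/-- The graded piece `B^(N) / B^(N-1)` of the order filtration. -/
abbrev gradedPiece (B : Subalgebra ℂ A2) (N : ℕ) : Type :=
  filt B (N + 1) ⧸ (filt B N).submoduleOf (filt B (N + 1))

/-- The scalar weight `w_k(x) = 2^(k₁+2k₂) (1-x)^(k₁+k₂-1/2) (1+x)^(k₂-1/2)`. -/
def w (k : ℝ × ℝ) (x : ℝ) : ℝ :=
  2 ^ (k.1 + 2 * k.2) * (1 - x) ^ (k.1 + k.2 - 1 / 2) * (1 + x) ^ (k.2 - 1 / 2)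

/-- The matrix weight `𝒲_k(x)`. -/
def weight (k : ℝ × ℝ) (x : ℝ) : Matrix (Fin 2) (Fin 2) ℂ :=
  (w k x : ℂ) • !![1, (x : ℂ); (x : ℂ), 1]

/-- The diagonal matrix weight `diag(w_{k₊}, w_{k₋})`, `k₊ = k + (1, 0)`, `k₋ = k + (-1, 1)`. -/
def diagWeight (k : ℝ × ℝ) (x : ℝ) : Matrix (Fin 2) (Fin 2) ℂ :=
  !![(w (k + (1, 0)) x : ℂ), 0; 0, (w (k + (-1, 1)) x : ℂ)]

/-- `ρ(k) = (k₁ + 2 k₂) / 2`. -/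
def rho (k : ℝ × ℝ) : ℝ := (k.1 + 2 * k.2) / 2

/-- The matrix `U`. -/
def U : Matrix (Fin 2) (Fin 2) ℂ := (1 / (Real.sqrt 2 : ℂ)) • !![1, -1; 1, 1]

/-- The constant operator `S`. -/
def S : A2 := opConst !![0, 1; 1, 0]

/-- The constant operator `S'`. -/
def S' : A2 := opConst !![1, 0; 0, -1]

/-- The first-order operator `𝒟_k`. -/
def opD (k : ℝ × ℝ) : A2 :=
  !![-wX, -1; 1, wX] * Matrix.scalar (Fin 2) wD +
    opConst !![-(rho k : ℂ), (k.1 : ℂ); 0, 1 + (rho k : ℂ)]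

/-- Conjugation of an operator by `U`. -/
def conjU (D : A2) : A2 := opConst U * D * opConst U⁻¹

/-- The first-order operator `𝔇_k = U 𝒟_k U⁻¹`. -/
def opFrakD (k : ℝ × ℝ) : A2 := conjU (opD k)

end JacobiDW

end

/-! The matrix `!![1, x; x, 1]` has constant eigenvectors, the rows of `U`, with eigenvalues 1 - x
and 1 + x. Hence conjugation by `U` turns 𝒲_k into half of diag(w_{k₊}, w_{k₋}), and the whole
question moves to a diagonal weight (`isMOP_weight_iff`, `mem_eigenAlgebra_iff_conjU_mem`).

Put a = k₁ + k₂ + 1/2 and b = k₂ + 1/2. The operators L = (1 - x)∂ - a and R = (1 + x)∂ + b are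
adjoint up to sign between the two scalar weights (`moment_adjoint`). If p_n is the eigenpolynomial
of RL of degree n, then p_n and L p_n are orthogonal for w_{k₊} and w_{k₋}, and both belong to the
eigenvalue -(n + a)(n + b), for RL and LR respectively. The diagonal family diag(p_n, L p_n) is
therefore orthogonal. Any other family is obtained from it by invertible constant right factors
(`IsMOP.exists_eq_mul_polyConst`), which do not change the algebra.

For this family, D lies in the algebra exactly when each D_ij sends the j-th polynomial of degree n
to a multiple of the i-th. Then D_ij intertwines RL or LR with RL or LR
(`IsLadder.mul_secondOrderPair`). Comparing top coefficients gives (1 - x²)α' = (ε - Nx)α for the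
coefficient α of ∂^N in D_ij, with ε in {0, 1, -1}. The polynomial solutions assemble into diag(c₀,
c₁) times the N-th power of the symbol of G = `opG a b`, the off-diagonal operator built from L and
R (`exists_eq_diagonal_mul_symbolG_pow`). So every D of order N agrees with some diag(c₀, c₁) G^N up
to lower order. Induction on the order yields the generators, and the two free constants yield the
dimension. Finally 𝔇_k is G plus a constant diagonal matrix (`opFrakD_eq`). -/

noncomputable section

namespace JacobiDW

/-! ### Scalar differential operators filtered by order -/

/-- Multiplication by a polynomial, as an endomorphism of `ℂ[x]`. -/
abbrev mulOp (p : ℂ[X]) : Module.End ℂ ℂ[X] := LinearMap.mulLeft ℂ p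

/-- Differentiation, as an endomorphism of `ℂ[x]`. -/
abbrev derivOp : Module.End ℂ ℂ[X] := Polynomial.derivative

/-- Scalar differential operators of order `< N`. -/
def diffLT (N : ℕ) : Submodule ℂ (Module.End ℂ ℂ[X]) where
  carrier := {T | ∃ a : ℕ → ℂ[X], ∀ f : ℂ[X],
    T f = ∑ m ∈ Finset.range N, a m * Polynomial.derivative^[m] f}
  add_mem' := by
    rintro D E ⟨a, ha⟩ ⟨b, hb⟩
    exact ⟨a + b, fun f => by simp [ha, hb, add_mul, Finset.sum_add_distrib]⟩
  zero_mem' := ⟨0, fun f => by simp⟩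
  smul_mem' := by
    rintro c D ⟨a, ha⟩
    exact ⟨fun m => c • a m, fun f => by simp [ha, Finset.smul_sum]⟩

lemma mem_ordLT {N : ℕ} {D : A2} :
    D ∈ ordLT N ↔ ∀ i j, (D i j : Module.End ℂ ℂ[X]) ∈ diffLT N := Iff.rfl

lemma derivOp_pow_apply (m : ℕ) (f : ℂ[X]) : (derivOp ^ m) f = Polynomial.derivative^[m] f := by
  rw [Module.End.pow_apply]

lemma mem_diffLT_iff {N : ℕ} {T : Module.End ℂ ℂ[X]} :
    T ∈ diffLT N ↔ ∃ a : ℕ → ℂ[X], T = ∑ m ∈ Finset.range N, mulOp (a m) * derivOp ^ m := by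
  refine exists_congr fun a => ⟨fun h => ?_, fun h f => ?_⟩
  · refine LinearMap.ext fun f => ?_
    simp [h, LinearMap.sum_apply, Module.End.pow_apply]
  · simp [h, LinearMap.sum_apply, Module.End.pow_apply]

lemma mulOp_mul_pow_mem {m N : ℕ} (h : m < N) (a : ℂ[X]) :
    mulOp a * derivOp ^ m ∈ diffLT N := by
  refine mem_diffLT_iff.2 ⟨fun i => if i = m then a else 0, ?_⟩
  rw [Finset.sum_eq_single m]
  · simp
  · intro i _ hi
    refine LinearMap.ext fun f => ?_
    simp [hi]
  · intro hm
    exact absurd (Finset.mem_range.2 h) hm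

lemma diffLT_induction {N : ℕ} {P : Module.End ℂ ℂ[X] → Prop}
    (hz : P 0) (ha : ∀ S T, P S → P T → P (S + T))
    (hm : ∀ m < N, ∀ a, P (mulOp a * derivOp ^ m)) {T : Module.End ℂ ℂ[X]}
    (hT : T ∈ diffLT N) : P T := by
  obtain ⟨a, rfl⟩ := mem_diffLT_iff.1 hT
  exact Finset.sum_induction _ P ha hz fun m hm' => hm m (Finset.mem_range.1 hm') _

lemma diffLT_mono : Monotone diffLT := fun _ N h _ hT =>
  diffLT_induction (P := (· ∈ diffLT N)) (zero_mem _) (fun _ _ => add_mem)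
    (fun _ hm a => mulOp_mul_pow_mem (hm.trans_le h) a) hT

lemma mulOp_mul (p q : ℂ[X]) : mulOp (p * q) = mulOp p * mulOp q := LinearMap.ext fun f => mul_assoc p q f

lemma mulOp_add (p q : ℂ[X]) : mulOp (p + q) = mulOp p + mulOp q :=
  LinearMap.ext fun f => add_mul p q f

lemma mulOp_sub (p q : ℂ[X]) : mulOp (p - q) = mulOp p - mulOp q :=
  LinearMap.ext fun f => sub_mul p q f

lemma mulOp_mul_mem {N : ℕ} (p : ℂ[X]) {T : Module.End ℂ ℂ[X]} (hT : T ∈ diffLT N) :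
    mulOp p * T ∈ diffLT N := by
  refine diffLT_induction (P := fun T => mulOp p * T ∈ diffLT N) (by simp)
    (fun S T hS hT => by rw [mul_add]; exact add_mem hS hT) (fun m hm a => ?_) hT
  rw [← mul_assoc, ← mulOp_mul]
  exact mulOp_mul_pow_mem hm _

lemma mul_derivOp_mem {N : ℕ} {T : Module.End ℂ ℂ[X]} (hT : T ∈ diffLT N) :
    T * derivOp ∈ diffLT (N + 1) := by
  refine diffLT_induction (P := fun T => T * derivOp ∈ diffLT (N + 1)) (by simp)
    (fun S T hS hT => by rw [add_mul]; exact add_mem hS hT) (fun m hm a => ?_) hT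
  rw [mul_assoc, ← pow_succ]
  exact mulOp_mul_pow_mem (by omega) _

lemma derivOp_mul_mulOp (p : ℂ[X]) :
    derivOp * mulOp p = mulOp p * derivOp + mulOp (derivative p) := by
  refine LinearMap.ext fun f => ?_
  simp [Polynomial.derivative_mul, add_comm]

lemma derivOp_mul_mem {N : ℕ} {T : Module.End ℂ ℂ[X]} (hT : T ∈ diffLT N) :
    derivOp * T ∈ diffLT (N + 1) := by
  refine diffLT_induction (P := fun T => derivOp * T ∈ diffLT (N + 1)) (by simp)
    (fun S T hS hT => by rw [mul_add]; exact add_mem hS hT) (fun m hm a => ?_) hT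
  rw [← mul_assoc, derivOp_mul_mulOp, add_mul, mul_assoc, ← pow_succ']
  exact add_mem (mulOp_mul_pow_mem (by omega) _) (mulOp_mul_pow_mem (by omega) _)

lemma derivOp_pow_mul_mem {N : ℕ} (m : ℕ) {T : Module.End ℂ ℂ[X]} (hT : T ∈ diffLT N) :
    derivOp ^ m * T ∈ diffLT (N + m) := by
  induction m with
  | zero => simpa using hT
  | succ m ih => rw [pow_succ', mul_assoc]; exact derivOp_mul_mem ih

/-- Orders are bounded strictly: factors of order at most M - 1 and N - 1 have a product of order at
most M + N - 2. If M or N is zero, the product vanishes. -/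
lemma diffLT_mul {M N : ℕ} {S T : Module.End ℂ ℂ[X]} (hS : S ∈ diffLT M) (hT : T ∈ diffLT N) :
    S * T ∈ diffLT (M + N - 1) := by
  refine diffLT_induction (P := fun S => S * T ∈ diffLT (M + N - 1)) (by simp)
    (fun S S' hS hS' => by rw [add_mul]; exact add_mem hS hS') (fun m hm a => ?_) hS
  rw [mul_assoc]
  exact mulOp_mul_mem _ (diffLT_mono (by omega) (derivOp_pow_mul_mem m hT))

lemma mulOp_mem (p : ℂ[X]) : mulOp p ∈ diffLT 1 := by
  simpa using mulOp_mul_pow_mem (m := 0) (N := 1) (by omega) p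

lemma derivOp_mem : derivOp ∈ diffLT 2 := by
  have h := mulOp_mul_pow_mem (m := 1) (N := 2) (by omega) 1
  rwa [mulOp, LinearMap.mulLeft_one, ← Module.End.one_eq_id, one_mul, pow_one] at h

lemma exists_diffLT (T : Weyl) : ∃ N, (T : Module.End ℂ ℂ[X]) ∈ diffLT N := by
  obtain ⟨T, hT⟩ := T
  induction hT using Algebra.adjoin_induction with
  | mem x hx =>
    rcases hx with rfl | rfl
    · exact ⟨1, mulOp_mem X⟩
    · exact ⟨2, derivOp_mem⟩
  | algebraMap r =>
    refine ⟨1, ?_⟩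
    have h := mulOp_mem (C r)
    convert h using 1
    refine LinearMap.ext fun f => ?_
    simp [Module.algebraMap_end_apply, Polynomial.smul_eq_C_mul]
  | add x y _ _ hx hy =>
    obtain ⟨M, hM⟩ := hx
    obtain ⟨N, hN⟩ := hy
    exact ⟨max M N, add_mem (diffLT_mono (le_max_left _ _) hM) (diffLT_mono (le_max_right _ _) hN)⟩
  | mul x y _ _ hx hy =>
    obtain ⟨M, hM⟩ := hx
    obtain ⟨N, hN⟩ := hy
    exact ⟨_, diffLT_mul hM hN⟩

lemma exists_ordLT (D : A2) : ∃ N, D ∈ ordLT N := by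
  choose f hf using fun p : Fin 2 × Fin 2 => exists_diffLT (D p.1 p.2)
  exact ⟨Finset.univ.sup f, fun i j =>
    diffLT_mono (Finset.le_sup (f := f) (Finset.mem_univ (i, j))) (hf (i, j))⟩

/-! ### Top coefficients -/

/-- `T` is a differential operator of order at most `N` whose coefficient of `∂ₓ^N` is `a`. -/
def HasTop (N : ℕ) (T : Module.End ℂ ℂ[X]) (a : ℂ[X]) : Prop :=
  T - mulOp a * derivOp ^ N ∈ diffLT N

lemma exists_hasTop {N : ℕ} {T : Module.End ℂ ℂ[X]} (hT : T ∈ diffLT (N + 1)) :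
    ∃ a, HasTop N T a := by
  obtain ⟨a, rfl⟩ := mem_diffLT_iff.1 hT
  refine ⟨a N, ?_⟩
  rw [HasTop, Finset.sum_range_succ, add_sub_cancel_right]
  exact mem_diffLT_iff.2 ⟨a, rfl⟩

lemma HasTop.mem {N : ℕ} {T : Module.End ℂ ℂ[X]} {a : ℂ[X]} (h : HasTop N T a) :
    T ∈ diffLT (N + 1) := by
  rw [← sub_add_cancel T (mulOp a * derivOp ^ N)]
  exact add_mem (diffLT_mono (Nat.le_succ N) h) (mulOp_mul_pow_mem (Nat.lt_succ_self N) a)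

lemma HasTop.add {N : ℕ} {S T : Module.End ℂ ℂ[X]} {a b : ℂ[X]} (hS : HasTop N S a)
    (hT : HasTop N T b) : HasTop N (S + T) (a + b) := by
  have := add_mem hS hT
  rw [HasTop, mulOp_add, add_mul]
  convert this using 1
  abel

lemma HasTop.sub {N : ℕ} {S T : Module.End ℂ ℂ[X]} {a b : ℂ[X]} (hS : HasTop N S a)
    (hT : HasTop N T b) : HasTop N (S - T) (a - b) := by
  have := sub_mem hS hT
  rw [HasTop, mulOp_sub, sub_mul]
  convert this using 1
  abel

lemma hasTop_zero_iff {N : ℕ} {T : Module.End ℂ ℂ[X]} : HasTop N T 0 ↔ T ∈ diffLT N := by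
  simp [HasTop]

lemma hasTop_mulOp (p : ℂ[X]) : HasTop 0 (mulOp p) p := by simp [HasTop]

lemma iterate_derivative_sub_pow_eval {m N : ℕ} (h : m < N) (c : ℂ) :
    (derivative^[m] ((X - C c) ^ N)).eval c = 0 := by
  rw [Polynomial.iterate_derivative_X_sub_pow]
  simp [Nat.sub_ne_zero_of_lt h]

/-- Test on (x - c)^N: all derivatives of order below N vanish at c, while the N-th one gives N!
a(c). This makes top coefficients unique. -/
lemma eq_zero_of_mulOp_mem {N : ℕ} {a : ℂ[X]} (h : mulOp a * derivOp ^ N ∈ diffLT N) : a = 0 := by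
  obtain ⟨b, hb⟩ := h
  refine Polynomial.funext fun c => ?_
  have h1 := congrArg (Polynomial.eval c) (hb ((X - C c) ^ N))
  rw [Module.End.mul_apply, derivOp_pow_apply, LinearMap.mulLeft_apply,
    Polynomial.iterate_derivative_X_sub_pow_self, eval_mul, eval_finsetSum,
    Finset.sum_eq_zero] at h1
  · simpa [Nat.factorial_ne_zero] using h1
  · intro m hm
    rw [eval_mul, iterate_derivative_sub_pow_eval (Finset.mem_range.1 hm), mul_zero]

lemma HasTop.eq_zero {N : ℕ} {T : Module.End ℂ ℂ[X]} {a : ℂ[X]} (h : HasTop N T a)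
    (hT : T ∈ diffLT N) : a = 0 := by
  refine eq_zero_of_mulOp_mem (N := N) ?_
  have := sub_mem hT h
  rwa [sub_sub_cancel] at this

lemma derivOp_pow_mul_mulOp_sub_mem (m : ℕ) (p : ℂ[X]) :
    derivOp ^ m * mulOp p - mulOp p * derivOp ^ m ∈ diffLT m := by
  induction m with
  | zero => simp
  | succ m ih =>
    have h := add_mem (derivOp_mul_mem ih)
      (mulOp_mul_pow_mem (Nat.lt_succ_self m) (derivative p))
    convert h using 1
    have h2 := derivOp_mul_mulOp p
    rw [pow_succ', mul_sub, ← mul_assoc derivOp (mulOp p), h2]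
    noncomm_ring

lemma HasTop.mul {M N : ℕ} {S T : Module.End ℂ ℂ[X]} {a b : ℂ[X]} (hS : HasTop M S a)
    (hT : HasTop N T b) : HasTop (M + N) (S * T) (a * b) := by
  -- The error ST - ab∂^(M+N) is the sum of (S - a∂^M)T, a∂^M(T - b∂^N) and a(∂^M b - b∂^M)∂^N, each
  -- of order below M + N.
  have h1 := diffLT_mul hS hT.mem
  have h2 := diffLT_mul (mulOp_mul_pow_mem (Nat.lt_succ_self M) a) hT
  have h3 := diffLT_mul (diffLT_mul (mulOp_mem a) (derivOp_pow_mul_mulOp_sub_mem M b))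
    (mulOp_mul_pow_mem (Nat.lt_succ_self N) 1)
  have h := add_mem (add_mem (diffLT_mono (by omega : _ ≤ M + N) h1)
    (diffLT_mono (by omega : _ ≤ M + N) h2)) (diffLT_mono (by omega : _ ≤ M + N) h3)
  rw [HasTop]
  convert h using 1
  rw [mulOp_mul, pow_add, mulOp, mulOp, mulOp, LinearMap.mulLeft_one, ← Module.End.one_eq_id]
  simp only [mul_sub, sub_mul, mul_assoc, one_mul]
  abel

/-! ### Commutators with second order operators -/

lemma derivOp_pow_mul_mulOp_mul_derivOp (m : ℕ) (p : ℂ[X]) :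
    derivOp ^ m * mulOp p * derivOp - mulOp p * derivOp ^ (m + 1)
      - m • (mulOp (derivative p) * derivOp ^ m) ∈ diffLT m := by
  induction m generalizing p with
  | zero => simp
  | succ m ih =>
    have h := add_mem (add_mem (mul_derivOp_mem (ih p)) (diffLT_mono (Nat.le_succ m)
      (ih (derivative p)))) (nsmul_mem (mulOp_mul_pow_mem (Nat.lt_succ_self m)
        (derivative (derivative p))) m)
    convert h using 1
    refine LinearMap.ext fun f => ?_
    simp [pow_succ, Polynomial.derivative_mul]
    ring

/-- The second order operator `s ∂ₓ² + r ∂ₓ + c`. -/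
def secondOrder (s r c : ℂ[X]) : Module.End ℂ ℂ[X] :=
  mulOp s * derivOp ^ 2 + mulOp r * derivOp + mulOp c

/-- Both second order operators share the coefficient s, so the terms of order N + 2 cancel. At
order N + 1 the Leibniz rule leaves a(N s' + r) from the first product and 2 s a' + r' a from the
second. -/
lemma hasTop_twistedCommutator_monomial (N : ℕ) (a s r r' c c' : ℂ[X]) :
    HasTop (N + 1) (mulOp a * derivOp ^ N * secondOrder s r c
      - secondOrder s r' c' * (mulOp a * derivOp ^ N))
      (N * derivative s * a + (r - r') * a - 2 * s * derivative a) := by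
  have e1 := mul_derivOp_mem (mulOp_mul_mem a (derivOp_pow_mul_mulOp_mul_derivOp N s))
  have e2 := diffLT_mono (Nat.le_succ N)
    (mulOp_mul_mem a (derivOp_pow_mul_mulOp_mul_derivOp N r))
  have e3 := mulOp_mul_pow_mem (Nat.lt_succ_self N) (N * derivative r * a)
  have e4 := diffLT_mul (mulOp_mul_pow_mem (Nat.lt_succ_self N) a) (mulOp_mem c)
  have e5 := mulOp_mul_pow_mem (Nat.lt_succ_self N)
    (s * derivative (derivative a) + r' * derivative a + c' * a)
  have h := sub_mem (add_mem (add_mem (add_mem e1 e2) e3) e4) e5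
  rw [HasTop]
  convert h using 1
  refine LinearMap.ext fun f => ?_
  have hd : ∀ g : ℂ[X], derivative ((derivOp ^ N) g) = (derivOp ^ N) (derivative g) := fun g => by
    simp only [derivOp_pow_apply, ← Function.iterate_succ_apply, ← Function.iterate_succ_apply']
  simp only [secondOrder, pow_succ, pow_zero, one_mul, LinearMap.sub_apply, LinearMap.add_apply,
    Module.End.mul_apply, LinearMap.mulLeft_apply, LinearMap.smul_apply, map_add,
    Polynomial.derivative_mul, hd]
  simp only [nsmul_eq_mul, derivOp]
  ring

lemma twistedCommutator_mem {N : ℕ} {T : Module.End ℂ ℂ[X]} (hT : T ∈ diffLT N)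
    (s r r' c c' : ℂ[X]) :
    T * secondOrder s r c - secondOrder s r' c' * T ∈ diffLT (N + 1) := by
  refine diffLT_induction (P := fun T => T * secondOrder s r c - secondOrder s r' c' * T
    ∈ diffLT (N + 1)) (by simp) (fun S T hS hT => ?_) (fun m hm a => ?_) hT
  · have := add_mem hS hT
    convert this using 1
    simp only [add_mul, mul_add]
    abel
  · exact diffLT_mono (by omega) (hasTop_twistedCommutator_monomial m a s r r' c c').mem

lemma HasTop.twistedCommutator {N : ℕ} {T : Module.End ℂ ℂ[X]} {a : ℂ[X]} (h : HasTop N T a)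
    (s r r' c c' : ℂ[X]) :
    HasTop (N + 1) (T * secondOrder s r c - secondOrder s r' c' * T)
      (N * derivative s * a + (r - r') * a - 2 * s * derivative a) := by
  have h1 := hasTop_twistedCommutator_monomial N a s r r' c c'
  have h2 := hasTop_zero_iff.2 (twistedCommutator_mem h s r r' c c')
  have h3 := h1.add h2
  rw [add_zero] at h3
  convert h3 using 1
  simp only [sub_mul, mul_sub]
  abel

/-! ### Polynomial solutions of the equation for top coefficients -/

/-- If `(1 - x²) a' = (ε - N x) a` and `a` is a polynomial with `2 ≤ N`, then `1 - x²` divides `a`,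
and the quotient solves the equation with `N - 2` in place of `N`. -/
lemma exists_quotient_of_ode {N : ℕ} {ε : ℂ} (hε : ε = 0 ∨ ε = 1 ∨ ε = -1) {a : ℂ[X]}
    (h : (1 - X ^ 2) * derivative a = (C ε - ((N + 2 : ℕ) : ℂ[X]) * X) * a) :
    ∃ b, a = (1 - X ^ 2) * b ∧ (1 - X ^ 2) * derivative b = (C ε - (N : ℂ[X]) * X) * b := by
  have hN : ∀ z : ℤ, z ≠ 0 → (z : ℂ) ≠ 0 := fun z hz => by exact_mod_cast hz
  have h1 := congrArg (Polynomial.eval 1) h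
  have h2 := congrArg (Polynomial.eval (-1)) h
  simp only [eval_mul, eval_sub, eval_one, eval_pow, eval_X, eval_C, eval_natCast] at h1 h2
  -- At x = ±1 the left side vanishes, and ε ∓ (N + 2) is nonzero because N + 2 exceeds |ε|.
  have k1 : a.eval 1 = 0 := by
    have hc : ε - ((N + 2 : ℕ) : ℂ) * 1 ≠ 0 := by
      rcases hε with rfl | rfl | rfl
      · have := hN (-(N + 2)) (by omega); push_cast at this ⊢; convert this using 1; ring
      · have := hN (-(N + 1)) (by omega); push_cast at this ⊢; convert this using 1; ring
      · have := hN (-(N + 3)) (by omega); push_cast at this ⊢; convert this using 1; ring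
    have : (ε - ((N + 2 : ℕ) : ℂ) * 1) * a.eval 1 = 0 := by rw [← h1]; ring
    exact (mul_eq_zero.1 this).resolve_left hc
  have k2 : a.eval (-1) = 0 := by
    have hc : ε - ((N + 2 : ℕ) : ℂ) * (-1) ≠ 0 := by
      rcases hε with rfl | rfl | rfl
      · have := hN (N + 2) (by omega); push_cast at this ⊢; convert this using 1; ring
      · have := hN (N + 3) (by omega); push_cast at this ⊢; convert this using 1; ring
      · have := hN (N + 1) (by omega); push_cast at this ⊢; convert this using 1; ring
    have : (ε - ((N + 2 : ℕ) : ℂ) * (-1)) * a.eval (-1) = 0 := by rw [← h2]; ring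
    exact (mul_eq_zero.1 this).resolve_left hc
  obtain ⟨c, rfl⟩ := Polynomial.dvd_iff_isRoot.2 k1
  have k3 : c.eval (-1) = 0 := by
    simp only [eval_mul, eval_sub, eval_X, eval_C] at k2
    exact (mul_eq_zero.1 k2).resolve_left (by norm_num)
  obtain ⟨b, rfl⟩ := Polynomial.dvd_iff_isRoot.2 k3
  have e : (X - C (1 : ℂ)) * ((X - C (-1)) * b) = (1 - X ^ 2) * (-b) := by
    simp only [map_neg, map_one]; ring
  refine ⟨-b, e, ?_⟩
  rw [e] at h
  have hs : (1 - X ^ 2 : ℂ[X]) ≠ 0 := fun h0 => by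
    have := congrArg (Polynomial.eval 0) h0
    simp at this
  apply mul_left_cancel₀ hs
  simp only [Polynomial.derivative_mul, derivative_sub, derivative_one, derivative_X_pow] at h
  push_cast at h
  simp only [map_ofNat] at h
  linear_combination h

/-- With d the degree of a, the coefficient of x^(d+1) gives -d = -N after division by the leading
coefficient. -/
lemma natDegree_of_ode {N : ℕ} {ε : ℂ} {a : ℂ[X]} (ha : a ≠ 0)
    (h : (1 - X ^ 2) * derivative a = (C ε - (N : ℂ[X]) * X) * a) : a.natDegree = N := by
  have h1 := congrArg (fun p => Polynomial.coeff p (a.natDegree + 1)) h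
  have e1 : (1 - X ^ 2) * derivative a = derivative a - derivative a * X * X := by ring
  have e2 : (C ε - (N : ℂ[X]) * X) * a = C ε * a - C (N : ℂ) * (a * X) := by
    rw [C_eq_natCast]; ring
  simp only [e1, e2, coeff_sub, coeff_mul_X, coeff_C_mul] at h1
  rw [coeff_derivative, coeff_eq_zero_of_natDegree_lt (p := a) (by omega),
    coeff_eq_zero_of_natDegree_lt (p := a) (by omega)] at h1
  have hl : a.coeff a.natDegree ≠ 0 := by simpa using ha
  have h2 : (a.natDegree : ℂ) = N := by
    apply mul_right_cancel₀ hl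
    rcases hd : a.natDegree with _ | d
    · rw [hd] at h1
      simp at h1
      have : a.coeff 1 = 0 := coeff_eq_zero_of_natDegree_lt (by omega)
      rcases h1 with h1 | h1
      · simp [h1]
      · simp [h1]
    · rw [hd, coeff_mul_X, coeff_derivative] at h1
      push_cast at h1 ⊢
      linear_combination -h1
  exact_mod_cast h2

/-- The symbol `[[0, -(1 + x)], [1 - x, 0]]`. -/
def symbolG : M2X := !![0, -(1 + X); 1 - X, 0]

/-- The parity shift in the equations for the leading coefficients. -/
def shift : Matrix (Fin 2) (Fin 2) ℂ := !![0, 1; -1, 0]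

lemma symbolG_sq : symbolG * symbolG = Matrix.diagonal fun _ => -(1 - X ^ 2 : ℂ[X]) := by
  ext1 i j
  fin_cases i <;> fin_cases j <;> simp [symbolG] <;> ring

/-- The quotient by 1 - x² lowers N by two, matching the square of `symbolG`, so only N = 0 and N =
1 need solving. There the equation kills the off-diagonal and the diagonal entries respectively,
which is the parity of the powers of `symbolG`. -/
lemma exists_eq_diagonal_mul_symbolG_pow (N : ℕ) (A : M2X)
    (h : ∀ i j, (1 - X ^ 2) * derivative (A i j) = (C (shift i j) - (N : ℂ[X]) * X) * A i j) :
    ∃ c : Fin 2 → ℂ, A = Matrix.diagonal (fun i => C (c i)) * symbolG ^ N := by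
  induction N using Nat.twoStepInduction generalizing A with
  | zero =>
    have hdeg : ∀ i j, ∃ c, A i j = C c := fun i j => by
      by_cases h0 : A i j = 0
      · exact ⟨0, by simp [h0]⟩
      · exact ⟨_, eq_C_of_natDegree_eq_zero (natDegree_of_ode h0 (h i j))⟩
    choose c hc using hdeg
    have key : ∀ i j, shift i j * c i j = 0 := fun i j => by
      have e0 := congrArg (Polynomial.eval 0) (h i j)
      rw [hc] at e0
      simpa only [eval_mul, eval_sub, eval_X, eval_C, derivative_C, eval_zero, mul_zero, sub_zero,
        eq_comm] using e0
    refine ⟨fun i => c i i, ?_⟩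
    ext1 i j
    rw [hc]
    have := key i j
    fin_cases i <;> fin_cases j <;> simp [shift] at this ⊢ <;> exact this
  | one =>
    have hdeg : ∀ i j, ∃ c d, A i j = C c * X + C d := fun i j => by
      by_cases h0 : A i j = 0
      · exact ⟨0, 0, by simp [h0]⟩
      · exact ⟨_, _, eq_X_add_C_of_natDegree_le_one (natDegree_of_ode h0 (h i j)).le⟩
    choose c d hcd using hdeg
    have key : ∀ i j, c i j = shift i j * d i j ∧ d i j = shift i j * c i j := fun i j => by
      have hij := h i j
      rw [hcd] at hij
      have e0 := congrArg (Polynomial.eval 0) hij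
      have e1 := congrArg (Polynomial.eval 1) hij
      have e2 := congrArg (Polynomial.eval (-1)) hij
      simp only [derivative_add, derivative_C_mul, derivative_X, derivative_C, eval_mul, eval_sub,
        eval_add, eval_one, eval_pow, eval_X, eval_C, Nat.cast_one, eval_zero]
        at e0 e1 e2
      refine ⟨by linear_combination e0, ?_⟩
      linear_combination (e1 - e2) / 2
    -- The surviving entries are d₀₁(1 + x) and d₁₀(1 - x), to be compared with -(1 + x) and 1 - x
    -- in `symbolG`.
    refine ⟨![-d 0 1, d 1 0], ?_⟩
    ext1 i j
    rw [hcd]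
    have := key i j
    fin_cases i <;> fin_cases j <;> simp [shift, symbolG] at this ⊢
    · simp [this]
    · rw [this.1]; ring
    · rw [this.1]; simp; ring
    · simp [this]
  | more N ih _ =>
    have hs : ∀ i j, shift i j = 0 ∨ shift i j = 1 ∨ shift i j = -1 := fun i j => by
      fin_cases i <;> fin_cases j <;> simp [shift]
    choose B hB hB' using fun i j => exists_quotient_of_ode (hs i j) (h i j)
    obtain ⟨c, hc⟩ := ih (Matrix.of B) hB'
    -- The sign compensates for `symbolG` squaring to -(1 - x²).
    refine ⟨-c, ?_⟩
    have hA : A = (Matrix.diagonal fun _ => (1 - X ^ 2 : ℂ[X])) * Matrix.of B := by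
      ext1 i j
      simp [hB]
    have hsm : ∀ M : M2X, (Matrix.diagonal fun _ => (1 - X ^ 2 : ℂ[X])) * M = (1 - X ^ 2 : ℂ[X]) • M :=
      fun M => (Matrix.smul_eq_diagonal_mul M _).symm
    have hsq : symbolG * symbolG = -((1 - X ^ 2 : ℂ[X]) • (1 : M2X)) := by
      rw [symbolG_sq, ← Matrix.diagonal_neg, ← hsm, mul_one]
    have hd : (Matrix.diagonal fun i => C ((-c) i)) = -(Matrix.diagonal fun i => C (c i)) := by
      rw [Matrix.diagonal_neg]
      simp
    rw [hA, hc, hsm, pow_add, pow_two symbolG, hsq, hd]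
    simp only [mul_neg, neg_mul, Matrix.mul_smul, mul_one, neg_neg]

/-- The determinant of `symbolG` is 1 - x², so its powers can be cancelled by means of the adjugate.
-/
lemma eq_zero_of_diagonal_mul_symbolG_pow {N : ℕ} {c : Fin 2 → ℂ}
    (h : Matrix.diagonal (fun i => C (c i)) * symbolG ^ N = 0) : c = 0 := by
  have hdet : (symbolG ^ N).det ≠ 0 := by
    rw [Matrix.det_pow]
    refine pow_ne_zero _ fun h0 => ?_
    have := congrArg (Polynomial.eval 0) h0
    simp [symbolG, Matrix.det_fin_two] at this
  have h2 : Matrix.diagonal (fun i => C (c i)) * (symbolG ^ N * (symbolG ^ N).adjugate) = 0 := by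
    rw [← mul_assoc, h, zero_mul]
  rw [Matrix.mul_adjugate, Matrix.mul_smul, mul_one] at h2
  have h3 := (smul_eq_zero.1 h2).resolve_left hdet
  funext i
  simpa using congrFun (congrFun h3 i) i

/-! ### Integration against the scalar weight -/

open MeasureTheory

lemma intervalIntegrable_one_sub_rpow_mul {u v : ℝ} (hu : -1 < u) (hv : -1 < v) :
    IntervalIntegrable (fun x : ℝ => (1 - x) ^ u * (1 + x) ^ v) volume (-1) 1 := by
  have hl : IntervalIntegrable (fun x : ℝ => (1 + x) ^ v) volume (-1) 0 := by
    have := (intervalIntegral.intervalIntegrable_rpow' (a := 0) (b := 1) hv).comp_add_left 1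
    simpa using this
  have hr : IntervalIntegrable (fun x : ℝ => (1 - x) ^ u) volume 0 1 := by
    have := (intervalIntegral.intervalIntegrable_rpow' (a := 1) (b := 0) hu).comp_sub_left 1
    simpa using this
  refine IntervalIntegrable.trans (b := 0) ?_ ?_
  · refine hl.continuousOn_mul (f := fun x => (1 + x) ^ v) (g := fun x => (1 - x) ^ u) ?_
    refine ContinuousOn.rpow_const (by fun_prop) fun x hx => Or.inl ?_
    rw [Set.uIcc_of_le (by norm_num)] at hx
    linarith [hx.2]
  · refine hr.mul_continuousOn (f := fun x => (1 - x) ^ u) (g := fun x => (1 + x) ^ v) ?_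
    refine ContinuousOn.rpow_const (by fun_prop) fun x hx => Or.inl ?_
    rw [Set.uIcc_of_le (by norm_num)] at hx
    linarith [hx.1]

lemma continuous_eval_ofReal (h : ℂ[X]) : Continuous fun x : ℝ => h.eval (x : ℂ) :=
  h.continuous.comp Complex.continuous_ofReal

lemma intervalIntegrable_eval_mul_w {k : ℝ × ℝ} (hk2 : -(1 / 2) < k.2)
    (hk12 : -(1 / 2) < k.1 + k.2) (h : ℂ[X]) :
    IntervalIntegrable (fun x : ℝ => h.eval (x : ℂ) * (w k x : ℂ)) volume (-1) 1 := by
  have h1 : IntervalIntegrable (fun x => w k x) volume (-1) 1 := by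
    have := (intervalIntegrable_one_sub_rpow_mul (u := k.1 + k.2 - 1 / 2) (v := k.2 - 1 / 2)
      (by linarith) (by linarith)).const_mul (2 ^ (k.1 + 2 * k.2))
    simpa only [w, ← mul_assoc] using this
  have h2 : IntervalIntegrable (fun x => (w k x : ℂ)) volume (-1) 1 :=
    ⟨h1.1.ofReal, h1.2.ofReal⟩
  exact h2.continuousOn_mul (continuous_eval_ofReal h).continuousOn

/-- The functional `h ↦ ∫_{-1}^1 h(x) w_k(x) dx`. -/
def moment {k : ℝ × ℝ} (hk2 : -(1 / 2) < k.2) (hk12 : -(1 / 2) < k.1 + k.2) : ℂ[X] →ₗ[ℂ] ℂ where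
  toFun h := ∫ x in (-1 : ℝ)..1, h.eval (x : ℂ) * (w k x : ℂ)
  map_add' f g := by
    rw [← intervalIntegral.integral_add (intervalIntegrable_eval_mul_w hk2 hk12 f)
      (intervalIntegrable_eval_mul_w hk2 hk12 g)]
    simp only [eval_add, add_mul]
  map_smul' c f := by
    simp only [eval_smul, smul_eq_mul, mul_assoc, RingHom.id_apply,
      intervalIntegral.integral_const_mul]

section

variable {k : ℝ × ℝ} (hk2 : -(1 / 2) < k.2) (hk12 : -(1 / 2) < k.1 + k.2)

/-- Times w_k, the argument is the derivative of 2^(k₁+2k₂) h(x) (1 - x)^a (1 + x)^b, which vanishes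
at both endpoints because a and b are positive. -/
lemma moment_integration_by_parts (h : ℂ[X]) :
    moment hk2 hk12 ((1 - X ^ 2) * derivative h + (C ((k.2 + 1 / 2 : ℝ) : ℂ) * (1 - X)
      - C ((k.1 + k.2 + 1 / 2 : ℝ) : ℂ) * (1 + X)) * h) = 0 := by
  set a := k.1 + k.2 + 1 / 2 with ha
  set b := k.2 + 1 / 2 with hb
  have ha0 : 0 < a := by linarith
  have hb0 : 0 < b := by linarith
  set c : ℝ := 2 ^ (k.1 + 2 * k.2)
  set F : ℝ → ℂ := fun x => h.eval (x : ℂ) * ((c * (1 - x) ^ a * (1 + x) ^ b : ℝ) : ℂ) with hF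
  have hcont : ContinuousOn F (Set.Icc (-1) 1) := by
    refine ((continuous_eval_ofReal h).continuousOn).mul
      (Complex.continuous_ofReal.comp_continuousOn ?_)
    refine ContinuousOn.mul (ContinuousOn.mul continuousOn_const ?_) ?_
    · exact ContinuousOn.rpow_const (by fun_prop) fun x _ => Or.inr ha0.le
    · exact ContinuousOn.rpow_const (by fun_prop) fun x _ => Or.inr hb0.le
  have hderiv : ∀ x ∈ Set.Ioo (-1 : ℝ) 1, HasDerivAt F
      (((1 - X ^ 2) * derivative h + (C (b : ℂ) * (1 - X) - C (a : ℂ) * (1 + X)) * h).eval (x : ℂ)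
        * (w k x : ℂ)) x := by
    intro x hx
    have hx1 : 0 < 1 - x := by linarith [hx.2]
    have hx2 : 0 < 1 + x := by linarith [hx.1]
    have d0 : HasDerivAt (fun x : ℝ => h.eval (x : ℂ)) ((derivative h).eval (x : ℂ)) x :=
      (h.hasDerivAt (x : ℂ)).comp_ofReal
    have d1 := ((hasDerivAt_id x).const_sub 1).rpow_const (p := a) (Or.inl hx1.ne')
    have d2 := ((hasDerivAt_id x).const_add 1).rpow_const (p := b) (Or.inl hx2.ne')
    have d3 := d0.mul (((d1.const_mul c).mul d2).ofReal_comp)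
    refine (d3.congr_deriv ?_)
    have e1 : (1 - x) ^ a = (1 - x) ^ (a - 1) * (1 - x) := by
      rw [← Real.rpow_add_one hx1.ne', sub_add_cancel]
    have e2 : (1 + x) ^ b = (1 + x) ^ (b - 1) * (1 + x) := by
      rw [← Real.rpow_add_one hx2.ne', sub_add_cancel]
    have e3 : w k x = c * (1 - x) ^ (a - 1) * (1 + x) ^ (b - 1) := by
      rw [w, show a - 1 = k.1 + k.2 - 1 / 2 by ring, show b - 1 = k.2 - 1 / 2 by ring]
    simp only [id, e1, e2, e3, Pi.mul_apply]
    simp only [eval_add, eval_mul, eval_sub, eval_one, eval_pow, eval_X, eval_C]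
    push_cast
    ring
  have hint := intervalIntegral.integral_eq_sub_of_hasDerivAt_of_le (by norm_num) hcont hderiv
    (intervalIntegrable_eval_mul_w hk2 hk12 _)
  refine hint.trans ?_
  simp [hF, Real.zero_rpow ha0.ne', Real.zero_rpow hb0.ne']

/-- The integrand is g |f|² w_k on the real interval, positive away from the finitely many zeros of
f. -/
lemma moment_ne_zero {g : ℝ → ℝ} {q : ℂ[X]} {f : ℂ[X]} (hf : f ≠ 0)
    (hg : ∀ x ∈ Set.Ioo (-1 : ℝ) 1, 0 < g x) (hq : ∀ x : ℝ, q.eval (x : ℂ) = (g x : ℂ)) :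
    moment hk2 hk12 (q * (f.map (starRingEnd ℂ) * f)) ≠ 0 := by
  have hconj : ∀ x : ℝ, (f.map (starRingEnd ℂ)).eval (x : ℂ) = starRingEnd ℂ (f.eval (x : ℂ)) :=
    fun x => by
      have := Polynomial.eval_map_apply (starRingEnd ℂ) (x : ℂ) (p := f)
      rwa [Complex.conj_ofReal] at this
  set F : ℝ → ℝ := fun x => g x * Complex.normSq (f.eval (x : ℂ)) * w k x
  have hFe : ∀ x : ℝ, (q * (f.map (starRingEnd ℂ) * f)).eval (x : ℂ) * (w k x : ℂ) = (F x : ℂ) := by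
    intro x
    rw [eval_mul, eval_mul, hq, hconj, ← Complex.normSq_eq_conj_mul_self]
    simp only [F]
    push_cast
    ring
  have hFi : IntervalIntegrable F volume (-1) 1 := by
    have h1 := intervalIntegrable_eval_mul_w hk2 hk12 (q * (f.map (starRingEnd ℂ) * f))
    simp only [hFe] at h1
    exact ⟨h1.1.re, h1.2.re⟩
  have hwpos : ∀ x ∈ Set.Ioo (-1 : ℝ) 1, 0 < w k x := fun x hx => by
    have hx1 : 0 < 1 - x := by linarith [hx.2]
    have hx2 : 0 < 1 + x := by linarith [hx.1]
    unfold w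
    positivity
  have hfin : {x : ℝ | f.eval (x : ℂ) = 0}.Finite := by
    have := (f.roots.toFinset.finite_toSet).preimage
      (Complex.ofReal_injective.injOn (s := (Complex.ofReal ⁻¹' f.roots.toFinset)))
    refine this.subset fun x hx => ?_
    simpa [hf] using hx
  have hpos : 0 < ∫ x in (-1 : ℝ)..1, F x := by
    rw [intervalIntegral.integral_pos_iff_support_of_nonneg_ae' _ hFi]
    · refine ⟨by norm_num, ?_⟩
      have hsub : Set.Ioo (-1 : ℝ) 1 \ {x : ℝ | f.eval (x : ℂ) = 0} ⊆
          Function.support F ∩ Set.Ioc (-1) 1 := fun x hx =>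
        ⟨(mul_pos (mul_pos (hg x hx.1) (Complex.normSq_pos.2 hx.2)) (hwpos x hx.1)).ne',
          Set.Ioo_subset_Ioc_self hx.1⟩
      refine lt_of_lt_of_le ?_ (measure_mono hsub)
      rw [measure_sdiff_null (hfin.measure_zero _)]
      simp
    · rw [Set.uIoc_of_le (by norm_num), ← restrict_Ioo_eq_restrict_Ioc]
      filter_upwards [ae_restrict_mem measurableSet_Ioo] with x hx
      exact (mul_nonneg (mul_nonneg (hg x hx).le (Complex.normSq_nonneg _)) (hwpos x hx).le)
  change (∫ x in (-1 : ℝ)..1, (q * (f.map (starRingEnd ℂ) * f)).eval (x : ℂ) * (w k x : ℂ)) ≠ 0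
  simp only [hFe]
  rw [intervalIntegral.integral_ofReal]
  exact_mod_cast hpos.ne'

/-! ### Matrix pairings as moments -/

/-- The conjugate transpose of a matrix polynomial, for a real variable. -/
def starPoly (P : M2X) : M2X := (P.map (Polynomial.map (starRingEnd ℂ))).transpose

lemma evalAt_starPoly (P : M2X) (x : ℝ) : evalAt (starPoly P) x = (evalAt P x).conjTranspose := by
  ext1 i j
  have := Polynomial.eval_map_apply (starRingEnd ℂ) (x : ℂ) (p := P j i)
  rw [Complex.conj_ofReal] at this
  simpa [evalAt, starPoly] using this

lemma evalAt_mul (P Q : M2X) (x : ℝ) : evalAt (P * Q) x = evalAt P x * evalAt Q x :=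
  Matrix.map_mul (f := Polynomial.evalRingHom (x : ℂ))

lemma pairing_eq_moment {W : ℝ → Matrix (Fin 2) (Fin 2) ℂ} {M : M2X}
    (hW : ∀ x ∈ Set.Icc (-1 : ℝ) 1, W x = (w k x : ℂ) • evalAt M x) (P Q : M2X) :
    pairing W P Q = (starPoly P * M * Q).map (moment hk2 hk12) := by
  ext1 i j
  refine intervalIntegral.integral_congr fun x hx => ?_
  rw [Set.uIcc_of_le (by norm_num)] at hx
  change _ = (evalAt (starPoly P * M * Q) x) i j * (w k x : ℂ)
  rw [evalAt_mul, evalAt_mul, evalAt_starPoly, hW x hx]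
  simp [mul_comm]

/-- `𝒲_k / w_k`. -/
def weightMatrix : M2X := !![1, X; X, 1]

/-- `diag(w_{k₊}, w_{k₋}) / w_k`. -/
def diagWeightMatrix : M2X := !![2 * (1 - X), 0; 0, 2 * (1 + X)]

lemma weight_eq (k : ℝ × ℝ) (x : ℝ) : weight k x = (w k x : ℂ) • evalAt weightMatrix x := by
  ext1 i j
  fin_cases i <;> fin_cases j <;> simp [weight, evalAt, weightMatrix]

-- At an endpoint the base 1 - x or 1 + x is zero, and splitting off one factor from the power then
-- needs the raised exponent to be nonzero; the strict bounds on k guarantee this.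
include hk2 hk12 in
lemma diagWeight_eq {x : ℝ} (hx : x ∈ Set.Icc (-1 : ℝ) 1) :
    diagWeight k x = (w k x : ℂ) • evalAt diagWeightMatrix x := by
  have hx1 : 0 ≤ 1 - x := by linarith [hx.2]
  have hx2 : 0 ≤ 1 + x := by linarith [hx.1]
  have h2 : (2 : ℝ) ^ (k.1 + 2 * k.2 + 1) = 2 ^ (k.1 + 2 * k.2) * 2 :=
    Real.rpow_add_one (by norm_num) _
  have ep : w (k + (1, 0)) x = w k x * (2 * (1 - x)) := by
    have h1 := Real.rpow_add_one' hx1 (y := k.1 + k.2 - 1 / 2) (by linarith)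
    simp only [w, Prod.fst_add, Prod.snd_add, add_zero]
    rw [show k.1 + 1 + 2 * k.2 = k.1 + 2 * k.2 + 1 by ring, h2,
      show k.1 + 1 + k.2 - 1 / 2 = k.1 + k.2 - 1 / 2 + 1 by ring, h1]
    ring
  have em : w (k + (-1, 1)) x = w k x * (2 * (1 + x)) := by
    have h1 := Real.rpow_add_one' hx2 (y := k.2 - 1 / 2) (by linarith)
    simp only [w, Prod.fst_add, Prod.snd_add]
    rw [show k.1 + -1 + 2 * (k.2 + 1) = k.1 + 2 * k.2 + 1 by ring, h2,
      show k.1 + -1 + (k.2 + 1) - 1 / 2 = k.1 + k.2 - 1 / 2 by ring,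
      show k.2 + 1 - 1 / 2 = k.2 - 1 / 2 + 1 by ring, h1]
    ring
  ext1 i j
  fin_cases i <;> fin_cases j <;> simp [diagWeight, ep, em, evalAt, diagWeightMatrix]

lemma pairing_weight (P Q : M2X) : pairing (weight k) P Q
    = (starPoly P * weightMatrix * Q).map (moment hk2 hk12) :=
  pairing_eq_moment hk2 hk12 (fun x _ => weight_eq k x) P Q

lemma pairing_diagWeight (P Q : M2X) : pairing (diagWeight k) P Q
    = (starPoly P * diagWeightMatrix * Q).map (moment hk2 hk12) :=
  pairing_eq_moment hk2 hk12 (fun _ hx => diagWeight_eq hk2 hk12 hx) P Q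

end

/-! ### Ladder operators and their eigenpolynomials -/

/-- The operator `(1 - x) ∂ₓ - a`. -/
def opL (a : ℝ) : Module.End ℂ ℂ[X] := mulOp (1 - X) * derivOp - mulOp (C (a : ℂ))

/-- The operator `(1 + x) ∂ₓ + b`. -/
def opR (b : ℝ) : Module.End ℂ ℂ[X] := mulOp (1 + X) * derivOp + mulOp (C (b : ℂ))

lemma opL_apply (a : ℝ) (f : ℂ[X]) : opL a f = (1 - X) * derivative f - C (a : ℂ) * f := rfl

lemma opR_apply (b : ℝ) (f : ℂ[X]) : opR b f = (1 + X) * derivative f + C (b : ℂ) * f := rfl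

lemma coeff_X_mul_derivative (f : ℂ[X]) (n : ℕ) : (X * derivative f).coeff n = n * f.coeff n := by
  cases n with
  | zero => simp
  | succ n => rw [coeff_X_mul, coeff_derivative]; push_cast; ring

lemma coeff_opL (a : ℝ) (f : ℂ[X]) (n : ℕ) :
    (opL a f).coeff n = (n + 1) * f.coeff (n + 1) - (n + a) * f.coeff n := by
  rw [opL_apply, sub_mul, one_mul, coeff_sub, coeff_sub, coeff_X_mul_derivative, coeff_derivative,
    coeff_C_mul]
  ring

lemma coeff_opR (b : ℝ) (f : ℂ[X]) (n : ℕ) :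
    (opR b f).coeff n = (n + 1) * f.coeff (n + 1) + (n + b) * f.coeff n := by
  rw [opR_apply, add_mul, one_mul, coeff_add, coeff_add, coeff_X_mul_derivative, coeff_derivative,
    coeff_C_mul]
  ring

lemma map_conj_opL (a : ℝ) (f : ℂ[X]) :
    (opL a f).map (starRingEnd ℂ) = opL a (f.map (starRingEnd ℂ)) := by
  simp [opL_apply, Polynomial.derivative_map]

lemma map_conj_opR (b : ℝ) (f : ℂ[X]) :
    (opR b f).map (starRingEnd ℂ) = opR b (f.map (starRingEnd ℂ)) := by
  simp [opR_apply, Polynomial.derivative_map]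

/-- The eigenvalue of `opR b * opL a` on polynomials of degree `n`. -/
def eigenvalue (a b : ℝ) (n : ℕ) : ℝ := -((n + a) * (n + b))

lemma eigenvalue_injective {a b : ℝ} (ha : 0 < a) (hb : 0 < b) :
    Function.Injective (eigenvalue a b) := by
  intro m n h
  have h1 : ((m : ℝ) - n) * (m + n + a + b) = 0 := by
    unfold eigenvalue at h
    linear_combination -h
  rcases mul_eq_zero.1 h1 with h1 | h1
  · exact_mod_cast sub_eq_zero.1 h1
  · have : (0 : ℝ) < m + n + a + b := by positivity
    exact absurd h1 this.ne'

lemma coeff_opR_opL_of_natDegree_le {a b : ℝ} {f : ℂ[X]} {n m : ℕ} (hf : f.natDegree ≤ n)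
    (hm : n ≤ m) : (opR b (opL a f)).coeff m = eigenvalue a b m * f.coeff m := by
  rw [coeff_opR, coeff_opL, coeff_opL, coeff_eq_zero_of_natDegree_lt (n := m + 1) (by omega),
    coeff_eq_zero_of_natDegree_lt (n := m + 1 + 1) (by omega), eigenvalue]
  push_cast
  ring

/-- Subtracting the n-th eigenvalue from RL kills the coefficient of x^n, so polynomials of degree
at most n are mapped into those of degree below n, and a kernel exists by dimension. Distinctness of
the eigenvalues forces a kernel element to have degree exactly n. -/
lemma exists_eigenpolynomial {a b : ℝ} (ha : 0 < a) (hb : 0 < b) (n : ℕ) :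
    ∃ p : ℂ[X], p.degree = n ∧ opR b (opL a p) = (eigenvalue a b n : ℂ) • p := by
  set T : ℂ[X] →ₗ[ℂ] ℂ[X] := opR b * opL a - (eigenvalue a b n : ℂ) • 1 with hT
  have hTa : ∀ f, T f = opR b (opL a f) - (eigenvalue a b n : ℂ) • f := fun f => rfl
  have hmaps : ∀ f ∈ degreeLT ℂ (n + 1), T f ∈ degreeLT ℂ n := by
    intro f hf
    have hd : f.natDegree ≤ n := by
      rw [degreeLT_succ_eq_degreeLE, mem_degreeLE] at hf
      exact natDegree_le_of_degree_le hf
    rw [mem_degreeLT, degree_lt_iff_coeff_zero]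
    intro m hm
    rw [hTa, coeff_sub, coeff_smul, coeff_opR_opL_of_natDegree_le hd hm, smul_eq_mul]
    rcases hm.eq_or_lt with rfl | hm
    · ring
    · rw [coeff_eq_zero_of_natDegree_lt (by omega)]; ring
  have hfin : ∀ m, Module.finrank ℂ (degreeLT ℂ m) = m := fun m => by
    rw [(degreeLTEquiv ℂ m).finrank_eq, Module.finrank_fin_fun]
  have hft : ∀ m, Module.Finite ℂ (degreeLT ℂ m) := fun m =>
    Module.Finite.equiv (degreeLTEquiv ℂ m).symm
  have := hft n
  have := hft (n + 1)
  have hker := LinearMap.ker_ne_bot_of_finrank_lt (f := T.restrict hmaps)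
    (by rw [hfin, hfin]; omega)
  obtain ⟨⟨p, hp⟩, hp1, hp0⟩ := Submodule.exists_mem_ne_zero_of_ne_bot hker
  have hp0 : p ≠ 0 := fun h => hp0 (by simpa using h)
  have hp1 : T p = 0 := by
    have := congrArg Subtype.val (LinearMap.mem_ker.1 hp1)
    simpa using this
  rw [hTa, sub_eq_zero] at hp1
  refine ⟨p, ?_, hp1⟩
  rw [degree_eq_natDegree hp0]
  congr 1
  apply eigenvalue_injective ha hb
  have h1 := congrArg (fun f => f.coeff p.natDegree) hp1
  simp only [coeff_opR_opL_of_natDegree_le le_rfl le_rfl, coeff_smul, smul_eq_mul] at h1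
  have hl : p.coeff p.natDegree ≠ 0 := by simpa using hp0
  exact_mod_cast mul_right_cancel₀ hl h1

lemma degree_opL {a : ℝ} (ha : 0 < a) {p : ℂ[X]} {n : ℕ} (hp : p.degree = n) :
    (opL a p).degree = n := by
  have hd := natDegree_eq_of_degree_eq_some hp
  have h0 : p ≠ 0 := fun h => by simp [h] at hp
  refine degree_eq_of_le_of_coeff_ne_zero ?_ ?_
  · rw [degree_le_iff_coeff_zero]
    intro m hm
    have hm : n < m := by exact_mod_cast hm
    rw [coeff_opL, coeff_eq_zero_of_natDegree_lt (n := m + 1) (by omega),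
      coeff_eq_zero_of_natDegree_lt (n := m) (by omega)]
    ring
  · have hl : p.coeff n ≠ 0 := by rw [← hd]; simpa using h0
    have h1 : ((n : ℂ) + a) ≠ 0 := by
      have : (n : ℝ) + a ≠ 0 := by positivity
      exact_mod_cast this
    rw [coeff_opL, coeff_eq_zero_of_natDegree_lt (n := n + 1) (by omega), mul_zero, zero_sub]
    exact neg_ne_zero.2 (mul_ne_zero h1 hl)

/-- A ladder of eigenpolynomials: `e 0 n` and `e 1 n` have degree `n`, and the first order
operators `opL a`, `opR b` map one to a multiple of the other. -/
structure IsLadder (a b : ℝ) (e : Fin 2 → ℕ → ℂ[X]) : Prop where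
  degree_eq : ∀ i n, (e i n).degree = n
  opL_eq : ∀ n, opL a (e 0 n) = e 1 n
  opR_eq : ∀ n, opR b (e 1 n) = (eigenvalue a b n : ℂ) • e 0 n

lemma exists_isLadder {a b : ℝ} (ha : 0 < a) (hb : 0 < b) : ∃ e, IsLadder a b e := by
  choose p hp hp' using exists_eigenpolynomial ha hb
  refine ⟨![p, fun n => opL a (p n)], ⟨fun i n => ?_, fun n => rfl, fun n => hp' n⟩⟩
  fin_cases i
  · exact hp n
  · exact degree_opL ha (hp n)

/-- The family of diagonal matrix polynomials with entries `e 0 n`, `e 1 n`. -/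
def diagFamily (e : Fin 2 → ℕ → ℂ[X]) (n : ℕ) : M2X := Matrix.diagonal fun i => e i n

/-! ### Orthogonality of the ladder -/

section Orthogonality

variable {k : ℝ × ℝ} (hk2 : -(1 / 2) < k.2) (hk12 : -(1 / 2) < k.1 + k.2)

/-- The two integrands sum to the exact expression of `moment_integration_by_parts` for the product
f g. -/
lemma moment_adjoint (f g : ℂ[X]) :
    moment hk2 hk12 ((1 - X) * opR (k.2 + 1 / 2) f * g)
      = -moment hk2 hk12 ((1 + X) * f * opL (k.1 + k.2 + 1 / 2) g) := by
  rw [eq_neg_iff_add_eq_zero, ← map_add, ← moment_integration_by_parts hk2 hk12 (f * g)]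
  congr 1
  rw [opL_apply, opR_apply, Polynomial.derivative_mul]
  ring

variable {e : Fin 2 → ℕ → ℂ[X]}

/-- Moving a ladder operator across in either direction expresses minus the second moment as λ_n,
and also as λ_m, times the first moment. As λ_m ≠ λ_n, both moments vanish. -/
lemma IsLadder.moment_eq_zero (he : IsLadder (k.1 + k.2 + 1 / 2) (k.2 + 1 / 2) e) {m n : ℕ}
    (hmn : m ≠ n) :
    moment hk2 hk12 ((1 - X) * ((e 0 m).map (starRingEnd ℂ) * e 0 n)) = 0 ∧
    moment hk2 hk12 ((1 + X) * ((e 1 m).map (starRingEnd ℂ) * e 1 n)) = 0 := by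
  set a := k.1 + k.2 + 1 / 2
  set b := k.2 + 1 / 2
  have hm1 : opL a ((e 0 m).map (starRingEnd ℂ)) = (e 1 m).map (starRingEnd ℂ) := by
    rw [← map_conj_opL, he.opL_eq]
  have hm2 : opR b ((e 1 m).map (starRingEnd ℂ))
      = (eigenvalue a b m : ℂ) • (e 0 m).map (starRingEnd ℂ) := by
    rw [← map_conj_opR, he.opR_eq, Polynomial.map_smul, Complex.conj_ofReal]
  have h1 := moment_adjoint hk2 hk12 (e 1 n) ((e 0 m).map (starRingEnd ℂ))
  have h2 := moment_adjoint hk2 hk12 ((e 1 m).map (starRingEnd ℂ)) (e 0 n)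
  rw [he.opR_eq, hm1] at h1
  rw [he.opL_eq, hm2] at h2
  have e1 : (1 - X) * (eigenvalue a b n : ℂ) • e 0 n * (e 0 m).map (starRingEnd ℂ)
      = (eigenvalue a b n : ℂ) • ((1 - X) * ((e 0 m).map (starRingEnd ℂ) * e 0 n)) := by
    simp only [smul_eq_C_mul]; ring
  have e2 : (1 - X) * (eigenvalue a b m : ℂ) • (e 0 m).map (starRingEnd ℂ) * e 0 n
      = (eigenvalue a b m : ℂ) • ((1 - X) * ((e 0 m).map (starRingEnd ℂ) * e 0 n)) := by
    simp only [smul_eq_C_mul]; ring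
  have e3 : (1 + X) * e 1 n * (e 1 m).map (starRingEnd ℂ)
      = (1 + X) * ((e 1 m).map (starRingEnd ℂ) * e 1 n) := by ring
  rw [e1, map_smul, e3, smul_eq_mul] at h1
  rw [e2, map_smul, mul_assoc, smul_eq_mul] at h2
  have hne : (eigenvalue a b m : ℂ) - eigenvalue a b n ≠ 0 := by
    rw [sub_ne_zero]
    exact fun h => hmn (eigenvalue_injective (by simp only [a]; linarith)
      (by simp only [b]; linarith) (Complex.ofReal_injective h))
  have h3 : moment hk2 hk12 ((1 - X) * ((e 0 m).map (starRingEnd ℂ) * e 0 n)) = 0 := by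
    refine (mul_eq_zero.1 ?_).resolve_left hne
    linear_combination h2 - h1
  refine ⟨h3, ?_⟩
  rw [h3] at h1
  linear_combination h1

lemma pairing_diagFamily (e : Fin 2 → ℕ → ℂ[X]) (m n : ℕ) :
    pairing (diagWeight k) (diagFamily e m) (diagFamily e n) = Matrix.diagonal
      ![2 * moment hk2 hk12 ((1 - X) * ((e 0 m).map (starRingEnd ℂ) * e 0 n)),
        2 * moment hk2 hk12 ((1 + X) * ((e 1 m).map (starRingEnd ℂ) * e 1 n))] := by
  have h2 : ∀ f, 2 * moment hk2 hk12 f = moment hk2 hk12 (2 * f) := fun f => by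
    rw [two_mul, two_mul, map_add]
  rw [pairing_diagWeight hk2 hk12]
  ext1 i j
  fin_cases i <;> fin_cases j <;>
    simp [starPoly, diagFamily, diagWeightMatrix, Matrix.mul_apply, Matrix.diagonal, h2] <;>
    ring_nf

include hk2 hk12 in
lemma IsLadder.isMOP (he : IsLadder (k.1 + k.2 + 1 / 2) (k.2 + 1 / 2) e) :
    IsMOP (diagWeight k) (diagFamily e) where
  degree_le n i j := by
    by_cases h : i = j
    · subst h
      rw [diagFamily, Matrix.diagonal_apply_eq]
      exact natDegree_le_of_degree_le (he.degree_eq i n).le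
    · simp [diagFamily, h]
  isUnit_lead n := by
    have h : ∀ i, (e i n).coeff n ≠ 0 := fun i =>
      coeff_ne_zero_of_eq_degree (he.degree_eq i n)
    rw [diagFamily, Matrix.diagonal_map (by simp), Matrix.isUnit_iff_isUnit_det,
      Matrix.det_diagonal, isUnit_iff_ne_zero]
    exact Finset.prod_ne_zero_iff.2 fun i _ => h i
  orthogonal m n hmn := by
    obtain ⟨h1, h2⟩ := he.moment_eq_zero hk2 hk12 hmn
    rw [pairing_diagFamily hk2 hk12, h1, h2]
    ext1 i j
    fin_cases i <;> fin_cases j <;> simp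

include hk2 hk12 in
lemma IsLadder.isUnit_pairing (he : IsLadder (k.1 + k.2 + 1 / 2) (k.2 + 1 / 2) e) (n : ℕ) :
    IsUnit (pairing (diagWeight k) (diagFamily e n) (diagFamily e n)) := by
  have h0 : ∀ i, e i n ≠ 0 := fun i h => by
    have := he.degree_eq i n
    simp [h] at this
  have h1 := moment_ne_zero hk2 hk12 (g := fun x => 1 - x) (q := 1 - X) (h0 0)
    (fun x hx => by linarith [hx.2]) (by simp)
  have h2 := moment_ne_zero hk2 hk12 (g := fun x => 1 + x) (q := 1 + X) (h0 1)
    (fun x hx => by linarith [hx.1]) (by simp)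
  rw [pairing_diagFamily hk2 hk12, Matrix.isUnit_iff_isUnit_det, Matrix.det_diagonal,
    isUnit_iff_ne_zero, Fin.prod_univ_two]
  exact mul_ne_zero (mul_ne_zero two_ne_zero h1) (mul_ne_zero two_ne_zero h2)

end Orthogonality

/-! ### Uniqueness of orthogonal families up to constant right factors -/

/-- All entries of `P` have degree `< N`. -/
def DegLT (N : ℕ) (P : M2X) : Prop := ∀ i j m, N ≤ m → (P i j).coeff m = 0

lemma DegLT.eq_zero {P : M2X} (hP : DegLT 0 P) : P = 0 := by
  ext i j m
  simp [hP i j m (Nat.zero_le m)]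

lemma coeff_mul_polyConst (P : M2X) (A : Matrix (Fin 2) (Fin 2) ℂ) (m : ℕ) :
    (P * polyConst A).map (fun p => p.coeff m) = P.map (fun p => p.coeff m) * A := by
  ext1 i j
  simp [polyConst, Matrix.mul_apply]

lemma IsMOP.degLT {W : ℝ → Matrix (Fin 2) (Fin 2) ℂ} {Q : ℕ → M2X} (hQ : IsMOP W Q) (n : ℕ) :
    DegLT (n + 1) (Q n) := fun i j m hm =>
  coeff_eq_zero_of_natDegree_lt (by have := hQ.degree_le n i j; omega)

lemma IsMOP.exists_sub_degLT {W : ℝ → Matrix (Fin 2) (Fin 2) ℂ} {Q : ℕ → M2X} (hQ : IsMOP W Q)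
    {N : ℕ} {P : M2X} (hP : DegLT (N + 1) P) :
    ∃ A, DegLT N (P - Q N * polyConst A) ∧
      (Q N).map (fun p => p.coeff N) * A = P.map fun p => p.coeff N := by
  obtain ⟨u, hu⟩ := hQ.isUnit_lead N
  have hA : (Q N).map (fun p => p.coeff N) * (u⁻¹.val * P.map fun p => p.coeff N)
      = P.map fun p => p.coeff N := by
    rw [← hu, ← mul_assoc, Units.mul_inv, one_mul]
  refine ⟨_, fun i j m hm => ?_, hA⟩
  have hc := congrFun (congrFun (coeff_mul_polyConst (Q N)
    (u⁻¹.val * P.map fun p => p.coeff N) m) i) j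
  rw [Matrix.sub_apply, coeff_sub]
  rw [Matrix.map_apply] at hc
  rw [hc]
  rcases hm.eq_or_lt with rfl | hm
  · rw [hA, Matrix.map_apply, sub_self]
  · have h0 : (Q N).map (fun p => p.coeff m) = 0 := by
      ext1 i j
      exact hQ.degLT N i j m hm
    rw [h0, zero_mul, hP i j m hm, Matrix.zero_apply, sub_zero]

section Uniqueness

variable {k : ℝ × ℝ} (hk2 : -(1 / 2) < k.2) (hk12 : -(1 / 2) < k.1 + k.2)

lemma starPoly_add (P Q : M2X) : starPoly (P + Q) = starPoly P + starPoly Q := by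
  ext1 i j
  simp [starPoly]

lemma starPoly_mul_polyConst (P : M2X) (A : Matrix (Fin 2) (Fin 2) ℂ) :
    starPoly (P * polyConst A) = polyConst A.conjTranspose * starPoly P := by
  ext1 i j
  simp [starPoly, polyConst, Matrix.mul_apply, mul_comm]

lemma starPoly_polyConst_mul (P : M2X) (A : Matrix (Fin 2) (Fin 2) ℂ) :
    starPoly (polyConst A * P) = starPoly P * polyConst A.conjTranspose := by
  ext1 i j
  simp [starPoly, polyConst, Matrix.mul_apply, mul_comm]

lemma map_mul_polyConst (I : ℂ[X] →ₗ[ℂ] ℂ) (P : M2X) (A : Matrix (Fin 2) (Fin 2) ℂ) :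
    (P * polyConst A).map I = P.map I * A := by
  have h : ∀ (p : ℂ[X]) (c : ℂ), I (p * C c) = I p * c := fun p c => by
    rw [mul_comm, ← smul_eq_C_mul, map_smul, smul_eq_mul, mul_comm]
  ext1 i j
  simp [polyConst, Matrix.mul_apply, h]

lemma map_polyConst_mul (I : ℂ[X] →ₗ[ℂ] ℂ) (P : M2X) (A : Matrix (Fin 2) (Fin 2) ℂ) :
    (polyConst A * P).map I = A * P.map I := by
  have h : ∀ (p : ℂ[X]) (c : ℂ), I (C c * p) = c * I p := fun p c => by
    rw [← smul_eq_C_mul, map_smul, smul_eq_mul]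
  ext1 i j
  simp [polyConst, Matrix.mul_apply, h]

include hk2 hk12

lemma pairing_add_left (P Q R : M2X) : pairing (diagWeight k) (P + Q) R
    = pairing (diagWeight k) P R + pairing (diagWeight k) Q R := by
  simp only [pairing_diagWeight hk2 hk12, starPoly_add, add_mul]
  exact Matrix.map_add _ (map_add _) _ _

lemma pairing_add_right (P Q R : M2X) : pairing (diagWeight k) P (Q + R)
    = pairing (diagWeight k) P Q + pairing (diagWeight k) P R := by
  simp only [pairing_diagWeight hk2 hk12, mul_add]
  exact Matrix.map_add _ (map_add _) _ _

lemma pairing_mul_polyConst_left (P Q : M2X) (A : Matrix (Fin 2) (Fin 2) ℂ) :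
    pairing (diagWeight k) (P * polyConst A) Q
      = A.conjTranspose * pairing (diagWeight k) P Q := by
  simp only [pairing_diagWeight hk2 hk12, starPoly_mul_polyConst, mul_assoc, map_polyConst_mul]

lemma pairing_mul_polyConst_right (P Q : M2X) (A : Matrix (Fin 2) (Fin 2) ℂ) :
    pairing (diagWeight k) P (Q * polyConst A) = pairing (diagWeight k) P Q * A := by
  simp only [pairing_diagWeight hk2 hk12, ← mul_assoc, map_mul_polyConst]

lemma pairing_zero_left (Q : M2X) : pairing (diagWeight k) 0 Q = 0 := by
  have := pairing_add_left hk2 hk12 0 0 Q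
  simpa using this

lemma pairing_zero_right (Q : M2X) : pairing (diagWeight k) Q 0 = 0 := by
  have := pairing_add_right hk2 hk12 Q 0 0
  simpa using this

lemma IsMOP.pairing_left_eq_zero {Q : ℕ → M2X} (hQ : IsMOP (diagWeight k) Q) {N n : ℕ}
    (hN : N ≤ n) {P : M2X} (hP : DegLT N P) : pairing (diagWeight k) P (Q n) = 0 := by
  induction N generalizing P with
  | zero => rw [hP.eq_zero, pairing_zero_left hk2 hk12]
  | succ N ih =>
    obtain ⟨A, hA, -⟩ := hQ.exists_sub_degLT hP
    have h1 := ih (by omega) hA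
    rw [← sub_add_cancel P (Q N * polyConst A), pairing_add_left hk2 hk12, h1,
      pairing_mul_polyConst_left hk2 hk12, hQ.orthogonal N n (by omega), mul_zero, add_zero]

lemma IsMOP.pairing_right_eq_zero {Q : ℕ → M2X} (hQ : IsMOP (diagWeight k) Q) {N n : ℕ}
    (hN : N ≤ n) {P : M2X} (hP : DegLT N P) : pairing (diagWeight k) (Q n) P = 0 := by
  induction N generalizing P with
  | zero => rw [hP.eq_zero, pairing_zero_right hk2 hk12]
  | succ N ih =>
    obtain ⟨A, hA, -⟩ := hQ.exists_sub_degLT hP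
    have h1 := ih (by omega) hA
    rw [← sub_add_cancel P (Q N * polyConst A), pairing_add_right hk2 hk12, h1,
      pairing_mul_polyConst_right hk2 hk12, hQ.orthogonal n N (by omega), zero_mul, add_zero]

lemma IsMOP.eq_zero_of_pairing_eq_zero {Q : ℕ → M2X} (hQ : IsMOP (diagWeight k) Q)
    (hu : ∀ n, IsUnit (pairing (diagWeight k) (Q n) (Q n))) {N : ℕ} {P : M2X} (hP : DegLT N P)
    (h : ∀ m < N, pairing (diagWeight k) (Q m) P = 0) : P = 0 := by
  induction N generalizing P with
  | zero => exact hP.eq_zero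
  | succ N ih =>
    obtain ⟨A, hA, -⟩ := hQ.exists_sub_degLT hP
    have h1 := hQ.pairing_right_eq_zero hk2 hk12 le_rfl hA
    have h2 := h N (Nat.lt_succ_self N)
    rw [← sub_add_cancel P (Q N * polyConst A), pairing_add_right hk2 hk12, h1,
      pairing_mul_polyConst_right hk2 hk12, zero_add] at h2
    have hA0 : A = 0 := (hu N).mul_right_eq_zero.1 h2
    rw [hA0, polyConst, Matrix.map_zero _ (map_zero _), mul_zero, sub_zero] at hA
    exact ih hA fun m hm => h m (by omega)

/-- Matching leading coefficients leaves a remainder of degree below n that is orthogonal to all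
lower Q_m, hence zero. Only the norms of one family must be invertible, so positivity is needed for
the ladder family alone. -/
lemma IsMOP.exists_eq_mul_polyConst {Q Q' : ℕ → M2X} (hQ : IsMOP (diagWeight k) Q)
    (hu : ∀ n, IsUnit (pairing (diagWeight k) (Q n) (Q n))) (hQ' : IsMOP (diagWeight k) Q')
    (n : ℕ) : ∃ A, IsUnit A ∧ Q' n = Q n * polyConst A := by
  obtain ⟨A, hA, hA'⟩ := hQ.exists_sub_degLT (hQ'.degLT n)
  refine ⟨A, isUnit_of_mul_isUnit_right (hA' ▸ hQ'.isUnit_lead n), sub_eq_zero.1 ?_⟩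
  refine hQ.eq_zero_of_pairing_eq_zero hk2 hk12 hu hA fun m hm => ?_
  have h1 := hQ'.pairing_left_eq_zero hk2 hk12 (show m + 1 ≤ n by omega) (hQ.degLT m)
  rw [← sub_add_cancel (Q' n) (Q n * polyConst A), pairing_add_right hk2 hk12,
    pairing_mul_polyConst_right hk2 hk12, hQ.orthogonal m n (by omega), zero_mul, add_zero] at h1
  exact h1

end Uniqueness

/-- Replacing Q_n by Q_n A only conjugates the eigenvalue matrix Λ_n by A. -/
lemma eigenAlgebra_congr {Q Q' : ℕ → M2X}
    (h : ∀ n, ∃ A, IsUnit A ∧ Q' n = Q n * polyConst A) : eigenAlgebra Q' = eigenAlgebra Q := by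
  ext D
  refine forall_congr' fun n => ?_
  obtain ⟨A, ⟨u, rfl⟩, hA⟩ := h n
  have hu : polyConst (u : Matrix (Fin 2) (Fin 2) ℂ) * polyConst u⁻¹.val = 1 := by
    rw [← polyConst_mul, Units.mul_inv, polyConst, Matrix.map_one _ (map_zero _) (map_one _)]
  rw [hA, act_mul_polyConst]
  constructor
  · rintro ⟨L, hL⟩
    refine ⟨u * L * u⁻¹.val, ?_⟩
    calc act D (Q n) = act D (Q n) * polyConst u * polyConst u⁻¹.val := by rw [mul_assoc, hu, mul_one]
      _ = _ := by rw [hL, polyConst_mul, polyConst_mul]; simp only [mul_assoc]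
  · rintro ⟨L, hL⟩
    refine ⟨u⁻¹.val * L * u, ?_⟩
    rw [hL, polyConst_mul, polyConst_mul]
    calc Q n * polyConst L * polyConst u
        = Q n * (polyConst u * polyConst u⁻¹.val) * polyConst L * polyConst u := by rw [hu, mul_one]
      _ = _ := by simp only [mul_assoc]

/-! ### Matrix operators and their top coefficients -/

lemma opConst_mul (A B : Matrix (Fin 2) (Fin 2) ℂ) : opConst (A * B) = opConst A * opConst B :=
  Matrix.map_mul

lemma opConst_one : opConst 1 = 1 := Matrix.map_one _ (map_zero _) (map_one _)

lemma opConst_add (A B : Matrix (Fin 2) (Fin 2) ℂ) : opConst (A + B) = opConst A + opConst B :=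
  Matrix.map_add _ (map_add _) _ _

lemma opConst_smul (c : ℂ) (A : Matrix (Fin 2) (Fin 2) ℂ) : opConst (c • A) = c • opConst A := by
  ext1 i j
  change algebraMap ℂ Weyl (c * A i j) = c • algebraMap ℂ Weyl (A i j)
  rw [map_mul, Algebra.smul_def]

lemma act_opConst (A : Matrix (Fin 2) (Fin 2) ℂ) (P : M2X) :
    act (opConst A) P = polyConst A * P := by
  ext1 i j
  simp [act, opConst, polyConst, Matrix.mul_apply, Module.algebraMap_end_apply, smul_eq_C_mul]

lemma opConst_mul_mem_ordLT {N : ℕ} {D : A2} (A : Matrix (Fin 2) (Fin 2) ℂ) (hD : D ∈ ordLT N) :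
    opConst A * D ∈ ordLT N := by
  intro i j
  have h : ((opConst A * D) i j : Module.End ℂ ℂ[X]) = ∑ l, A i l • (D l j : Module.End ℂ ℂ[X]) := by
    simp [opConst, Matrix.mul_apply, ← Algebra.smul_def]
  change ((opConst A * D) i j : Module.End ℂ ℂ[X]) ∈ diffLT N
  rw [h]
  exact Submodule.sum_mem _ fun l _ => Submodule.smul_mem _ _ (hD l j)

lemma mul_opConst_mem_ordLT {N : ℕ} {D : A2} (A : Matrix (Fin 2) (Fin 2) ℂ) (hD : D ∈ ordLT N) :
    D * opConst A ∈ ordLT N := by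
  intro i j
  have h : ((D * opConst A) i j : Module.End ℂ ℂ[X]) = ∑ l, A l j • (D i l : Module.End ℂ ℂ[X]) := by
    simp [opConst, Matrix.mul_apply, Algebra.smul_def, Algebra.commutes]
  change ((D * opConst A) i j : Module.End ℂ ℂ[X]) ∈ diffLT N
  rw [h]
  exact Submodule.sum_mem _ fun l _ => Submodule.smul_mem _ _ (hD i l)

/-- `D` is a matrix differential operator of order at most `N` whose coefficient of `∂ₓ^N`
is `A`. -/
def HasTopMatrix (N : ℕ) (D : A2) (A : M2X) : Prop :=
  ∀ i j, HasTop N (D i j : Module.End ℂ ℂ[X]) (A i j)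

lemma HasTopMatrix.mem {N : ℕ} {D : A2} {A : M2X} (h : HasTopMatrix N D A) : D ∈ ordLT (N + 1) :=
  fun i j => (h i j).mem

lemma HasTopMatrix.mul {M N : ℕ} {D E : A2} {A B : M2X} (hD : HasTopMatrix M D A)
    (hE : HasTopMatrix N E B) : HasTopMatrix (M + N) (D * E) (A * B) := fun i j => by
  have := ((hD i 0).mul (hE 0 j)).add ((hD i 1).mul (hE 1 j))
  simpa [Matrix.mul_apply, Fin.sum_univ_two] using this

lemma hasTopMatrix_opConst (A : Matrix (Fin 2) (Fin 2) ℂ) :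
    HasTopMatrix 0 (opConst A) (polyConst A) := fun i j => by
  have h : ((opConst A i j : Weyl) : Module.End ℂ ℂ[X]) = mulOp (polyConst A i j) :=
    LinearMap.ext fun f => by
      simp [opConst, polyConst, Module.algebraMap_end_apply, smul_eq_C_mul]
  rw [h]
  exact hasTop_mulOp _

lemma HasTopMatrix.pow {D : A2} {A : M2X} (h : HasTopMatrix 1 D A) (N : ℕ) :
    HasTopMatrix N (D ^ N) (A ^ N) := by
  induction N with
  | zero =>
    have := hasTopMatrix_opConst 1
    rwa [opConst_one, polyConst, Matrix.map_one _ (map_zero _) (map_one _)] at this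
  | succ N ih => rw [pow_succ, pow_succ]; exact ih.mul h

lemma HasTopMatrix.sub_mem {N : ℕ} {D E : A2} {A : M2X} (hD : HasTopMatrix N D A)
    (hE : HasTopMatrix N E A) : D - E ∈ ordLT N := fun i j => by
  have := (hD i j).sub (hE i j)
  rw [sub_self] at this
  exact hasTop_zero_iff.1 this

/-- The first order operator `[[0, -((1 + x) ∂ₓ + b)], [(1 - x) ∂ₓ - a, 0]]`. -/
def opG (a b : ℝ) : A2 :=
  !![0, -((1 + wX) * wD + algebraMap ℂ Weyl b); (1 - wX) * wD - algebraMap ℂ Weyl a, 0]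

lemma coe_opG_zero_one (a b : ℝ) : (opG a b 0 1 : Module.End ℂ ℂ[X]) = -opR b :=
  LinearMap.ext fun f => by
    simp [opG, opR_apply, wX, wD, Module.algebraMap_end_apply, smul_eq_C_mul, add_mul]

lemma coe_opG_one_zero (a b : ℝ) : (opG a b 1 0 : Module.End ℂ ℂ[X]) = opL a :=
  LinearMap.ext fun f => by
    simp [opG, opL_apply, wX, wD, Module.algebraMap_end_apply, smul_eq_C_mul, sub_mul]

lemma hasTop_opL (a : ℝ) : HasTop 1 (opL a) (1 - X) := by
  have := neg_mem (mulOp_mem (C (a : ℂ)))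
  rw [HasTop, opL, pow_one]
  convert this using 1
  abel

lemma hasTop_opR (b : ℝ) : HasTop 1 (opR b) (1 + X) := by
  have := mulOp_mem (C (b : ℂ))
  rw [HasTop, opR, pow_one]
  convert this using 1
  abel

lemma hasTopMatrix_opG (a b : ℝ) : HasTopMatrix 1 (opG a b) symbolG := fun i j => by
  have hz : HasTop 1 (0 : Module.End ℂ ℂ[X]) 0 := hasTop_zero_iff.2 (zero_mem _)
  fin_cases i <;> fin_cases j
  · exact hz
  · have := hz.sub (hasTop_opR b)
    rw [zero_sub, zero_sub, ← coe_opG_zero_one a b] at this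
    exact this
  · have := hasTop_opL a
    rw [← coe_opG_one_zero a b] at this
    exact this
  · exact hz

/-- The element `diag(c₀, c₁) G^N`. -/
def basicOp (a b : ℝ) (N : ℕ) (c : Fin 2 → ℂ) : A2 := opConst (Matrix.diagonal c) * opG a b ^ N

lemma hasTopMatrix_basicOp (a b : ℝ) (N : ℕ) (c : Fin 2 → ℂ) :
    HasTopMatrix N (basicOp a b N c) (Matrix.diagonal (fun i => C (c i)) * symbolG ^ N) := by
  have := (hasTopMatrix_opConst (Matrix.diagonal c)).mul ((hasTopMatrix_opG a b).pow N)
  rw [zero_add, polyConst, Matrix.diagonal_map (map_zero _)] at this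
  exact this

lemma mem_eigenAlgebra_diagFamily {e : Fin 2 → ℕ → ℂ[X]} {D : A2} :
    D ∈ eigenAlgebra (diagFamily e) ↔
      ∀ n i j, ∃ c : ℂ, (D i j : Module.End ℂ ℂ[X]) (e j n) = c • e i n := by
  have h1 : ∀ n i j, act D (diagFamily e n) i j = (D i j : Module.End ℂ ℂ[X]) (e j n) := by
    intro n i j
    fin_cases j <;> simp [act, diagFamily]
  have h2 : ∀ n L i j, (diagFamily e n * polyConst L) i j = L i j • e i n := by
    intro n L i j
    simp [diagFamily, polyConst, smul_eq_C_mul, mul_comm]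
  refine forall_congr' fun n => ⟨?_, fun h => ?_⟩
  · rintro ⟨L, hL⟩ i j
    exact ⟨L i j, by rw [← h1, hL, h2]⟩
  · choose L hL using h
    refine ⟨Matrix.of L, ?_⟩
    ext1 i j
    rw [h1, h2, hL]
    rfl

lemma opR_mul_opL (a b : ℝ) : opR b * opL a = secondOrder (1 - X ^ 2)
    (-(1 + X) - C (a : ℂ) * (1 + X) + C (b : ℂ) * (1 - X)) (-(C (a : ℂ) * C (b : ℂ))) :=
  LinearMap.ext fun f => by
    simp only [secondOrder, Module.End.mul_apply, LinearMap.add_apply, opR_apply, opL_apply, pow_two,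
      LinearMap.mulLeft_apply, derivative_sub, derivative_mul, derivative_one, derivative_X,
      derivative_C]
    ring

lemma opL_mul_opR (a b : ℝ) : opL a * opR b = secondOrder (1 - X ^ 2)
    ((1 - X) - C (a : ℂ) * (1 + X) + C (b : ℂ) * (1 - X)) (-(C (a : ℂ) * C (b : ℂ))) :=
  LinearMap.ext fun f => by
    simp only [secondOrder, Module.End.mul_apply, LinearMap.add_apply, opR_apply, opL_apply, pow_two,
      LinearMap.mulLeft_apply, derivative_add, derivative_mul, derivative_one, derivative_X,
      derivative_C]
    ring

/-! ### Structure of the algebra of the ladder family -/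

section Structure

variable {a b : ℝ} {e : Fin 2 → ℕ → ℂ[X]}

lemma IsLadder.span_eq_top (he : IsLadder a b e) (i : Fin 2) :
    Submodule.span ℂ (Set.range (e i)) = ⊤ := by
  let s : Polynomial.Sequence ℂ := ⟨e i, he.degree_eq i⟩
  exact s.span fun n => isUnit_iff_ne_zero.2 (leadingCoeff_ne_zero.2 fun h => by
    have := he.degree_eq i n
    rw [show e i n = 0 from h] at this
    simp at this)

/-- The second order operators with eigenpolynomials `e 0 n` and `e 1 n`. -/
def secondOrderPair (a b : ℝ) : Fin 2 → Module.End ℂ ℂ[X] := ![opR b * opL a, opL a * opR b]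

lemma IsLadder.secondOrderPair_apply (he : IsLadder a b e) (i : Fin 2) (n : ℕ) :
    secondOrderPair a b i (e i n) = (eigenvalue a b n : ℂ) • e i n := by
  fin_cases i
  · simp [secondOrderPair, he.opL_eq, he.opR_eq]
  · simp [secondOrderPair, he.opL_eq, he.opR_eq]

/-- Both sides multiply the image of `e j n` by the same eigenvalue, since RL and LR share their
spectrum degree by degree; the `e j n` span all polynomials. -/
lemma IsLadder.mul_secondOrderPair (he : IsLadder a b e) {D : A2}
    (hD : D ∈ eigenAlgebra (diagFamily e)) (i j : Fin 2) :
    (D i j : Module.End ℂ ℂ[X]) * secondOrderPair a b j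
      = secondOrderPair a b i * (D i j : Module.End ℂ ℂ[X]) := by
  refine LinearMap.ext_on (he.span_eq_top j) ?_
  rintro _ ⟨n, rfl⟩
  obtain ⟨c, hc⟩ := mem_eigenAlgebra_diagFamily.1 hD n i j
  rw [Module.End.mul_apply, Module.End.mul_apply, he.secondOrderPair_apply, map_smul, hc, map_smul,
    he.secondOrderPair_apply, smul_comm]

/-- The intertwining relation makes a twisted commutator vanish, so its coefficient at order N + 1
is zero. This is the differential equation whose solutions are the symbols of the `basicOp a b N c`.
-/
lemma IsLadder.exists_sub_basicOp_mem (he : IsLadder a b e) {D : A2}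
    (hD : D ∈ eigenAlgebra (diagFamily e)) {N : ℕ} (hN : D ∈ ordLT (N + 1)) :
    ∃ c, D - basicOp a b N c ∈ ordLT N := by
  choose A hA using fun i j => exists_hasTop (mem_ordLT.1 hN i j)
  have hA' : HasTopMatrix N D (Matrix.of A) := hA
  obtain ⟨c, hc⟩ := exists_eq_diagonal_mul_symbolG_pow N (Matrix.of A) fun i j => by
    have hcomm := he.mul_secondOrderPair hD i j
    have h2 : ∀ r r' c : ℂ[X], secondOrderPair a b j = secondOrder (1 - X ^ 2) r c →
        secondOrderPair a b i = secondOrder (1 - X ^ 2) r' c →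
        (N : ℂ[X]) * derivative (1 - X ^ 2) * A i j + (r - r') * A i j
          - 2 * (1 - X ^ 2) * derivative (A i j) = 0 := by
      intro r r' c hr hr'
      have h := (hA i j).twistedCommutator (1 - X ^ 2) r r' c c
      rw [← hr, ← hr', hcomm, sub_self] at h
      exact h.eq_zero (zero_mem _)
    -- The first order coefficients of LR and RL differ by (1 - x) + (1 + x) = 2, which is where
    -- `shift` comes from.
    have hj : ∃ r r' c : ℂ[X], secondOrderPair a b j = secondOrder (1 - X ^ 2) r c ∧
        secondOrderPair a b i = secondOrder (1 - X ^ 2) r' c ∧ r - r' = 2 * C (shift i j) := by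
      fin_cases i <;> fin_cases j
      · exact ⟨_, _, _, opR_mul_opL a b, opR_mul_opL a b, by simp [shift]⟩
      · exact ⟨_, _, _, opL_mul_opR a b, opR_mul_opL a b, by simp [shift]; ring⟩
      · exact ⟨_, _, _, opR_mul_opL a b, opL_mul_opR a b, by simp [shift]; ring⟩
      · exact ⟨_, _, _, opL_mul_opR a b, opL_mul_opR a b, by simp [shift]⟩
    obtain ⟨r, r', c, hr, hr', hrr⟩ := hj
    have h := h2 r r' c hr hr'
    rw [hrr, derivative_sub, derivative_one, derivative_X_pow] at h
    simp only [Matrix.of_apply]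
    refine mul_left_cancel₀ (two_ne_zero : (2 : ℂ[X]) ≠ 0) ?_
    simp only [Nat.cast_ofNat, map_ofNat, Nat.add_one_sub_one, pow_one] at h
    linear_combination -h
  rw [hc] at hA'
  exact ⟨c, hA'.sub_mem (hasTopMatrix_basicOp a b N c)⟩

lemma opConst_diagonal_mem_eigenAlgebra (c : Fin 2 → ℂ) :
    opConst (Matrix.diagonal c) ∈ eigenAlgebra (diagFamily e) := by
  refine mem_eigenAlgebra_diagFamily.2 fun n i j => ?_
  by_cases h : i = j
  · subst h
    exact ⟨c i, by simp [opConst, Module.algebraMap_end_apply]⟩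
  · exact ⟨0, by simp [opConst, h]⟩

lemma IsLadder.opG_mem (he : IsLadder a b e) : opG a b ∈ eigenAlgebra (diagFamily e) := by
  refine mem_eigenAlgebra_diagFamily.2 fun n i j => ?_
  fin_cases i <;> fin_cases j
  · exact ⟨0, by simp [opG]⟩
  · refine ⟨-(eigenvalue a b n : ℂ), ?_⟩
    have := coe_opG_zero_one a b
    simp only [Fin.zero_eta, Fin.mk_one, this, LinearMap.neg_apply, he.opR_eq, neg_smul]
  · refine ⟨1, ?_⟩
    have := coe_opG_one_zero a b
    simp only [Fin.zero_eta, Fin.mk_one, this, he.opL_eq, one_smul]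
  · exact ⟨0, by simp [opG]⟩

lemma IsLadder.basicOp_mem (he : IsLadder a b e) (N : ℕ) (c : Fin 2 → ℂ) :
    basicOp a b N c ∈ eigenAlgebra (diagFamily e) :=
  mul_mem (opConst_diagonal_mem_eigenAlgebra c) (pow_mem he.opG_mem N)

lemma ordLT_zero {D : A2} (hD : D ∈ ordLT 0) : D = 0 := by
  ext1 i j
  obtain ⟨c, hc⟩ := hD i j
  exact Subtype.ext (LinearMap.ext fun f => by simpa using hc f)

/-- Each subtraction of a `basicOp` stays in the algebra and lowers the order, until the operator is
zero. -/
lemma IsLadder.eigenAlgebra_le (he : IsLadder a b e) {B : Subalgebra ℂ A2}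
    (hB : ∀ N c, basicOp a b N c ∈ B) : eigenAlgebra (diagFamily e) ≤ B := by
  intro D hD
  obtain ⟨N, hN⟩ := exists_ordLT D
  induction N generalizing D with
  | zero => rw [ordLT_zero hN]; exact zero_mem _
  | succ N ih =>
    obtain ⟨c, hc⟩ := he.exists_sub_basicOp_mem hD hN
    rw [← sub_add_cancel D (basicOp a b N c)]
    exact add_mem (ih (sub_mem hD (he.basicOp_mem N c)) hc) (hB N c)

lemma basicOp_eq_zero_of_mem {N : ℕ} {c : Fin 2 → ℂ} (h : basicOp a b N c ∈ ordLT N) : c = 0 := by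
  refine eq_zero_of_diagonal_mul_symbolG_pow (N := N) ?_
  ext1 i j
  exact (hasTopMatrix_basicOp a b N c i j).eq_zero (h i j)

/-- `basicOp a b N` as a linear map. -/
def basicOpLin (a b : ℝ) (N : ℕ) : (Fin 2 → ℂ) →ₗ[ℂ] A2 where
  toFun := basicOp a b N
  map_add' c d := by
    rw [basicOp, basicOp, basicOp, ← add_mul, ← opConst_add, Matrix.diagonal_add]
    rfl
  map_smul' r c := by
    rw [basicOp, basicOp, Matrix.diagonal_smul, opConst_smul, smul_mul_assoc]
    rfl

end Structure

/-! ### Conjugation by the constant matrix `U` -/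

section Conjugation

lemma one_div_sqrt_two_mul_self : (1 / (Real.sqrt 2 : ℂ)) * (1 / (Real.sqrt 2 : ℂ)) = 1 / 2 := by
  rw [div_mul_div_comm, ← Complex.ofReal_mul, Real.mul_self_sqrt (by norm_num)]
  norm_num

lemma U_mul : U * ((1 / (Real.sqrt 2 : ℂ)) • !![1, 1; -1, 1]) = 1 := by
  rw [U, Matrix.smul_mul, Matrix.mul_smul, smul_smul, one_div_sqrt_two_mul_self]
  ext1 i j
  fin_cases i <;> fin_cases j <;> simp <;> norm_num

lemma U_inv : U⁻¹ = (1 / (Real.sqrt 2 : ℂ)) • !![1, 1; -1, 1] := Matrix.inv_eq_right_inv U_mul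

lemma U_mul_inv : U * U⁻¹ = 1 := by rw [U_inv, U_mul]

lemma U_inv_mul : U⁻¹ * U = 1 := mul_eq_one_comm.1 U_mul_inv

lemma conjTranspose_U : U.conjTranspose = U⁻¹ := by
  rw [U_inv, U]
  ext1 i j
  fin_cases i <;> fin_cases j <;> simp

lemma conjU_eq (D : A2) :
    conjU D = (1 / 2 : ℂ) • (opConst !![1, -1; 1, 1] * D * opConst !![1, 1; -1, 1]) := by
  rw [conjU, U_inv, U, opConst_smul, opConst_smul, smul_mul_assoc, smul_mul_assoc, mul_smul_comm,
    smul_smul, one_div_sqrt_two_mul_self]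

lemma opConst_mul_opConst_inv : opConst U * opConst U⁻¹ = 1 := by
  rw [← opConst_mul, U_mul_inv, opConst_one]

lemma opConst_inv_mul_opConst : opConst U⁻¹ * opConst U = 1 := by
  rw [← opConst_mul, U_inv_mul, opConst_one]

/-- Conjugation by `U` as an automorphism of `𝔸₂`. -/
def conjUEquiv : A2 ≃ₐ[ℂ] A2 where
  toFun := conjU
  invFun D := opConst U⁻¹ * D * opConst U
  left_inv D := by
    change opConst U⁻¹ * (opConst U * D * opConst U⁻¹) * opConst U = D
    calc _ = (opConst U⁻¹ * opConst U) * D * (opConst U⁻¹ * opConst U) := by simp only [mul_assoc]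
      _ = D := by rw [opConst_inv_mul_opConst, one_mul, mul_one]
  right_inv D := by
    change opConst U * (opConst U⁻¹ * D * opConst U) * opConst U⁻¹ = D
    calc _ = (opConst U * opConst U⁻¹) * D * (opConst U * opConst U⁻¹) := by simp only [mul_assoc]
      _ = D := by rw [opConst_mul_opConst_inv, one_mul, mul_one]
  map_mul' D E := by
    change opConst U * (D * E) * opConst U⁻¹
      = opConst U * D * opConst U⁻¹ * (opConst U * E * opConst U⁻¹)
    calc _ = opConst U * D * 1 * E * opConst U⁻¹ := by simp only [mul_assoc, mul_one]
      _ = _ := by rw [← opConst_inv_mul_opConst]; simp only [mul_assoc]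
  map_add' D E := by simp only [conjU, mul_add, add_mul]
  commutes' c := by
    rw [conjU, ← Algebra.commutes, mul_assoc, opConst_mul_opConst_inv, mul_one]

lemma conjU_mem_ordLT {N : ℕ} {D : A2} (hD : D ∈ ordLT N) : conjU D ∈ ordLT N :=
  mul_opConst_mem_ordLT _ (opConst_mul_mem_ordLT _ hD)

lemma conjUEquiv_symm_mem_ordLT {N : ℕ} {D : A2} (hD : D ∈ ordLT N) :
    conjUEquiv.symm D ∈ ordLT N :=
  mul_opConst_mem_ordLT _ (opConst_mul_mem_ordLT _ hD)

lemma conjU_S : conjU S = -S' := by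
  have h : (1 / 2 : ℂ) • (!![1, -1; 1, 1] * !![0, 1; 1, 0] * !![1, 1; -1, 1])
      = (-1 : ℂ) • (!![1, 0; 0, -1] : Matrix (Fin 2) (Fin 2) ℂ) := by
    ext1 i j
    fin_cases i <;> fin_cases j <;> norm_num [Matrix.mul_apply]
  rw [conjU_eq, S, ← opConst_mul, ← opConst_mul, ← opConst_smul, h, opConst_smul, neg_one_smul, S']

lemma conjU_fin_two (D : A2) : conjU D = (1 / 2 : ℂ) •
    !![D 0 0 - D 1 0 - D 0 1 + D 1 1, D 0 0 - D 1 0 + D 0 1 - D 1 1;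
      D 0 0 + D 1 0 - D 0 1 - D 1 1, D 0 0 + D 1 0 + D 0 1 + D 1 1] := by
  have h1 : opConst !![1, -1; 1, 1] = !![1, -1; 1, 1] := by
    ext1 i j
    fin_cases i <;> fin_cases j <;> simp [opConst]
  have h2 : opConst !![1, 1; -1, 1] = !![1, 1; -1, 1] := by
    ext1 i j
    fin_cases i <;> fin_cases j <;> simp [opConst]
  rw [conjU_eq, h1, h2]
  congr 1
  ext1 i j
  simp only [Matrix.mul_apply, Fin.sum_univ_two]
  fin_cases i <;> fin_cases j <;> simp <;> abel

lemma opD_fin_two (k : ℝ × ℝ) : opD k = !![-(wX * wD) - algebraMap ℂ Weyl (rho k),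
    -wD + algebraMap ℂ Weyl k.1; wD, wX * wD + (1 + algebraMap ℂ Weyl (rho k))] := by
  ext1 i j
  fin_cases i <;> fin_cases j <;>
    simp [opD, opConst, sub_eq_add_neg]

/-- The first order part of 𝒟_k becomes off-diagonal under `U`. The correction is a constant
diagonal matrix, thus a combination of I and S', so 𝔇_k and G are interchangeable as generators. -/
lemma opFrakD_eq (k : ℝ × ℝ) : opFrakD k = opG (k.1 + k.2 + 1 / 2) (k.2 + 1 / 2)
    + opConst (Matrix.diagonal ![(1 - (k.1 : ℂ)) / 2, (1 + (k.1 : ℂ)) / 2]) := by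
  have hrho : (rho k : ℂ) = (k.1 + 2 * k.2) / 2 := by rw [rho]; push_cast; ring
  have half : ∀ T : Weyl, T = (1 / 2 : ℂ) • (T + T) := fun T => by
    rw [← two_smul ℂ T, smul_smul]; norm_num
  have hc : ∀ c : ℂ, algebraMap ℂ Weyl c = c • 1 := fun c => Algebra.algebraMap_eq_smul_one c
  rw [opFrakD, conjU_fin_two, opD_fin_two, hrho]
  ext1 i j
  fin_cases i <;> fin_cases j
  · simp [opG, opConst, hc]
    module
  · simp [opG, opConst, hc, add_mul]
    module
  · simp [opG, opConst, hc, sub_mul]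
    module
  · simp [opG, opConst, hc]
    module

end Conjugation

/-! ### Transfer between the two matrix weights -/

section Transfer

lemma polyConst_one : polyConst 1 = 1 := Matrix.map_one _ (map_zero _) (map_one _)

lemma polyConst_U_mul_inv : polyConst U * polyConst U⁻¹ = 1 := by
  rw [← polyConst_mul, U_mul_inv, polyConst_one]

lemma polyConst_U_inv_mul : polyConst U⁻¹ * polyConst U = 1 := by
  rw [← polyConst_mul, U_inv_mul, polyConst_one]

lemma conj_diagWeightMatrix :
    polyConst U.conjTranspose * diagWeightMatrix * polyConst U = (2 : ℂ) • weightMatrix := by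
  have hV : ∀ (c : ℂ) (A : Matrix (Fin 2) (Fin 2) ℂ), polyConst (c • A) = c • polyConst A :=
    fun c A => by
      ext1 i j
      simp [polyConst, smul_eq_C_mul]
  have h1 : polyConst !![1, 1; -1, 1] * diagWeightMatrix * polyConst !![1, -1; 1, 1]
      = (4 : ℂ) • weightMatrix := by
    ext1 i j
    simp only [Matrix.mul_apply, Fin.sum_univ_two]
    have h4 : (C 4 : ℂ[X]) = 4 := map_ofNat C 4
    fin_cases i <;> fin_cases j <;>
      simp [polyConst, diagWeightMatrix, weightMatrix, smul_eq_C_mul, h4] <;> ring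
  rw [conjTranspose_U, U_inv, U, hV, hV, smul_mul_assoc, smul_mul_assoc, mul_smul_comm, smul_smul,
    one_div_sqrt_two_mul_self, h1, smul_smul]
  norm_num

variable {k : ℝ × ℝ} (hk2 : -(1 / 2) < k.2) (hk12 : -(1 / 2) < k.1 + k.2)

include hk2 hk12

lemma pairing_diagWeight_U_mul (P Q : M2X) :
    pairing (diagWeight k) (polyConst U * P) (polyConst U * Q) = (2 : ℂ) • pairing (weight k) P Q := by
  have h : starPoly (polyConst U * P) * diagWeightMatrix * (polyConst U * Q)
      = (2 : ℂ) • (starPoly P * weightMatrix * Q) := by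
    calc _ = starPoly P * (polyConst U.conjTranspose * diagWeightMatrix * polyConst U) * Q := by
          rw [starPoly_polyConst_mul]
          simp only [mul_assoc]
      _ = _ := by rw [conj_diagWeightMatrix, mul_smul_comm, smul_mul_assoc]
  rw [pairing_diagWeight hk2 hk12, pairing_weight hk2 hk12, h]
  ext1 i j
  simp

lemma isMOP_weight_iff (Q : ℕ → M2X) :
    IsMOP (weight k) Q ↔ IsMOP (diagWeight k) fun n => polyConst U * Q n := by
  have hdeg : ∀ (A : Matrix (Fin 2) (Fin 2) ℂ) (P : M2X) (n : ℕ),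
      (∀ i j, (P i j).natDegree ≤ n) → ∀ i j, ((polyConst A * P) i j).natDegree ≤ n := by
    intro A P n h i j
    rw [Matrix.mul_apply]
    exact natDegree_sum_le_of_forall_le _ _ fun l _ => (natDegree_C_mul_le _ _).trans (h l j)
  have hlead : ∀ n, ((polyConst U * Q n).map fun p => p.coeff n)
      = U * (Q n).map fun p => p.coeff n := by
    intro n
    ext1 i j
    simp [polyConst, Matrix.mul_apply]
  have hU : IsUnit U := IsUnit.of_mul_eq_one _ U_mul_inv
  have hinv : ∀ P : M2X, polyConst U⁻¹ * (polyConst U * P) = P := fun P => by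
    rw [← mul_assoc, polyConst_U_inv_mul, one_mul]
  constructor
  · intro h
    refine ⟨fun n => hdeg U _ n (h.degree_le n), fun n => ?_, fun m n hmn => ?_⟩
    · rw [hlead]
      exact hU.mul (h.isUnit_lead n)
    · rw [pairing_diagWeight_U_mul hk2 hk12, h.orthogonal m n hmn, smul_zero]
  · intro h
    refine ⟨fun n => ?_, fun n => ?_, fun m n hmn => ?_⟩
    · have := hdeg U⁻¹ _ n (h.degree_le n)
      rwa [hinv] at this
    · have := h.isUnit_lead n
      rw [hlead] at this
      exact isUnit_of_mul_isUnit_right this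
    · have := h.orthogonal m n hmn
      rw [pairing_diagWeight_U_mul hk2 hk12] at this
      exact (smul_eq_zero.1 this).resolve_left two_ne_zero

omit hk2 hk12

lemma mem_eigenAlgebra_iff_conjU_mem (Q : ℕ → M2X) (D : A2) :
    D ∈ eigenAlgebra Q ↔ conjU D ∈ eigenAlgebra fun n => polyConst U * Q n := by
  have h : ∀ P, act (conjU D) (polyConst U * P) = polyConst U * act D P := fun P => by
    rw [conjU, act_mul, act_mul, act_opConst, act_opConst, ← mul_assoc (polyConst U⁻¹),
      polyConst_U_inv_mul, one_mul]
  refine forall_congr' fun n => exists_congr fun L => ?_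
  rw [h, mul_assoc]
  refine ⟨fun h => by rw [h], fun h => ?_⟩
  have := congrArg (polyConst U⁻¹ * ·) h
  simpa only [← mul_assoc, polyConst_U_inv_mul, one_mul] using this

end Transfer

/-! ### Generators and graded dimensions -/

section Generators

variable {k : ℝ × ℝ} {e : Fin 2 → ℕ → ℂ[X]}

lemma opConst_diagonal_eq (c : Fin 2 → ℂ) :
    opConst (Matrix.diagonal c) = ((c 0 + c 1) / 2) • (1 : A2) + ((c 0 - c 1) / 2) • S' := by
  rw [S', ← opConst_one, ← opConst_smul, ← opConst_smul, ← opConst_add]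
  congr 1
  ext1 i j
  fin_cases i <;> fin_cases j <;> simp <;> ring

lemma IsLadder.eigenAlgebra_eq (he : IsLadder (k.1 + k.2 + 1 / 2) (k.2 + 1 / 2) e) :
    eigenAlgebra (diagFamily e) = Algebra.adjoin ℂ {1, S', opFrakD k} := by
  set B := Algebra.adjoin ℂ {1, S', opFrakD k} with hB
  have hS : S' ∈ B := Algebra.subset_adjoin (by simp)
  have hD : opFrakD k ∈ B := Algebra.subset_adjoin (by simp)
  have hdiag : ∀ c, opConst (Matrix.diagonal c) ∈ B := fun c => by
    rw [opConst_diagonal_eq]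
    exact add_mem (B.smul_mem (one_mem B) _) (B.smul_mem hS _)
  refine le_antisymm (he.eigenAlgebra_le fun N c => mul_mem (hdiag c) (pow_mem ?_ N)) ?_
  · rw [eq_sub_of_add_eq (opFrakD_eq k).symm]
    exact sub_mem hD (hdiag _)
  · refine Algebra.adjoin_le ?_
    rintro _ (rfl | rfl | rfl)
    · exact one_mem _
    · have : (!![1, 0; 0, -1] : Matrix (Fin 2) (Fin 2) ℂ) = Matrix.diagonal ![1, -1] := by
        ext1 i j
        fin_cases i <;> fin_cases j <;> simp
      rw [S', this]
      exact opConst_diagonal_mem_eigenAlgebra _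
    · rw [opFrakD_eq]
      exact add_mem he.opG_mem (opConst_diagonal_mem_eigenAlgebra _)

/-- Conjugation is an automorphism carrying one generating set to the other, except that S goes to
-S', which generates the same algebra. -/
lemma conjU_mem_adjoin_iff (k : ℝ × ℝ) (D : A2) :
    conjU D ∈ Algebra.adjoin ℂ {1, S', opFrakD k} ↔ D ∈ Algebra.adjoin ℂ {1, S, opD k} := by
  have h : Algebra.adjoin ℂ {1, S', opFrakD k}
      = (Algebra.adjoin ℂ {1, S, opD k}).map (conjUEquiv : A2 →ₐ[ℂ] A2) := by
    have h1 : (conjUEquiv : A2 →ₐ[ℂ] A2) '' {1, S, opD k} = {1, -S', opFrakD k} := by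
      rw [Set.image_insert_eq, Set.image_pair, map_one]
      change {1, conjU S, conjU (opD k)} = _
      rw [conjU_S]
      rfl
    rw [AlgHom.map_adjoin, h1]
    refine le_antisymm (Algebra.adjoin_le ?_) (Algebra.adjoin_le ?_)
    · rintro _ (rfl | rfl | rfl)
      · exact one_mem _
      · rw [← neg_neg S']
        exact neg_mem (Algebra.subset_adjoin (by simp))
      · exact Algebra.subset_adjoin (by simp)
    · rintro _ (rfl | rfl | rfl)
      · exact one_mem _
      · exact neg_mem (Algebra.subset_adjoin (by simp))
      · exact Algebra.subset_adjoin (by simp)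
  rw [h, Subalgebra.mem_map]
  constructor
  · rintro ⟨E, hE, hED⟩
    rwa [← conjUEquiv.injective hED]
  · exact fun hD => ⟨D, hD, rfl⟩

/-- After conjugation, c ↦ diag(c) G^N identifies ℂ² with the graded piece: injectively because the
top coefficient determines c, surjectively by `IsLadder.exists_sub_basicOp_mem`. -/
lemma finrank_gradedPiece {a b : ℝ} (he : IsLadder a b e) {B : Subalgebra ℂ A2}
    (hB : ∀ D, D ∈ B ↔ conjU D ∈ eigenAlgebra (diagFamily e)) (N : ℕ) :
    Module.finrank ℂ (gradedPiece B N) = 2 := by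
  have hconj : ∀ D, conjU (conjUEquiv.symm D) = D := conjUEquiv.apply_symm_apply
  let φ : (Fin 2 → ℂ) →ₗ[ℂ] filt B (N + 1) :=
    (conjUEquiv.symm.toLinearMap ∘ₗ basicOpLin a b N).codRestrict (filt B (N + 1)) fun c => by
      refine ⟨(hB _).2 ?_, conjUEquiv_symm_mem_ordLT (hasTopMatrix_basicOp a b N c).mem⟩
      change conjU (conjUEquiv.symm (basicOp a b N c)) ∈ _
      rw [hconj]
      exact he.basicOp_mem N c
  let ψ : (Fin 2 → ℂ) →ₗ[ℂ] gradedPiece B N := Submodule.mkQ _ ∘ₗ φ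
  have hφ : ∀ c, (φ c : A2) = conjUEquiv.symm (basicOp a b N c) := fun c => rfl
  have hinj : Function.Injective ψ := by
    rw [← LinearMap.ker_eq_bot, LinearMap.ker_eq_bot']
    intro c hc
    have h1 : (φ c : A2) ∈ filt B N :=
      (Submodule.Quotient.mk_eq_zero ((filt B N).submoduleOf (filt B (N + 1)))).1 hc
    have h2 := conjU_mem_ordLT h1.2
    rw [hφ, hconj] at h2
    exact basicOp_eq_zero_of_mem h2
  have hsurj : Function.Surjective ψ := by
    intro x
    obtain ⟨⟨D, hDB, hDN⟩, rfl⟩ := Submodule.mkQ_surjective _ x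
    obtain ⟨c, hc⟩ := he.exists_sub_basicOp_mem ((hB D).1 hDB) (conjU_mem_ordLT hDN)
    refine ⟨c, Eq.symm ((Submodule.Quotient.eq _).2 ?_)⟩
    refine ⟨sub_mem hDB (φ c).2.1, ?_⟩
    have h := conjUEquiv_symm_mem_ordLT hc
    rw [map_sub] at h
    rwa [show conjUEquiv.symm (conjU D) = D from conjUEquiv.symm_apply_apply D] at h
  rw [← (LinearEquiv.ofBijective ψ ⟨hinj, hsurj⟩).finrank_eq, Module.finrank_fin_fun]

end Generators

end JacobiDW

end

theorem mainTheorem5 (k : ℝ × ℝ) (hk2 : -(1 / 2) < k.2) (hk12 : -(1 / 2) < k.1 + k.2) :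
    (∃ Q, JacobiDW.IsMOP (JacobiDW.weight k) Q) ∧
    (∃ Q, JacobiDW.IsMOP (JacobiDW.diagWeight k) Q) ∧
    (∀ Q, JacobiDW.IsMOP (JacobiDW.weight k) Q →
      JacobiDW.eigenAlgebra Q = Algebra.adjoin ℂ {1, JacobiDW.S, JacobiDW.opD k} ∧
      ∀ N : ℕ, Module.finrank ℂ (JacobiDW.gradedPiece (JacobiDW.eigenAlgebra Q) N) = 2) ∧
    (∀ Q', JacobiDW.IsMOP (JacobiDW.diagWeight k) Q' →
      JacobiDW.eigenAlgebra Q' = Algebra.adjoin ℂ {1, JacobiDW.S', JacobiDW.opFrakD k}) ∧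
    (∀ Q Q', JacobiDW.IsMOP (JacobiDW.weight k) Q → JacobiDW.IsMOP (JacobiDW.diagWeight k) Q' →
      ∀ D : JacobiDW.A2,
        D ∈ JacobiDW.eigenAlgebra Q ↔ JacobiDW.conjU D ∈ JacobiDW.eigenAlgebra Q') := by
  -- Here a and b are the exponents of 1 - x and 1 + x in w_k raised by one; the hypotheses on k say
  -- exactly that they are positive.
  obtain ⟨e, he⟩ := JacobiDW.exists_isLadder (a := k.1 + k.2 + 1 / 2) (b := k.2 + 1 / 2)
    (by linarith) (by linarith)
  have hcanon := he.isMOP hk2 hk12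
  have hdiag : ∀ Q', JacobiDW.IsMOP (JacobiDW.diagWeight k) Q' →
      JacobiDW.eigenAlgebra Q' = JacobiDW.eigenAlgebra (JacobiDW.diagFamily e) := fun Q' hQ' =>
    JacobiDW.eigenAlgebra_congr
      (hcanon.exists_eq_mul_polyConst hk2 hk12 (he.isUnit_pairing hk2 hk12) hQ')
  have hconj : ∀ Q, JacobiDW.IsMOP (JacobiDW.weight k) Q → ∀ D, D ∈ JacobiDW.eigenAlgebra Q ↔
      JacobiDW.conjU D ∈ JacobiDW.eigenAlgebra (JacobiDW.diagFamily e) := fun Q hQ D => by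
    rw [JacobiDW.mem_eigenAlgebra_iff_conjU_mem,
      hdiag _ ((JacobiDW.isMOP_weight_iff hk2 hk12 Q).1 hQ)]
  refine ⟨⟨fun n => JacobiDW.polyConst JacobiDW.U⁻¹ * JacobiDW.diagFamily e n, ?_⟩,
    ⟨_, hcanon⟩, fun Q hQ => ⟨?_, ?_⟩, fun Q' hQ' => ?_, fun Q Q' hQ hQ' D => ?_⟩
  · rw [JacobiDW.isMOP_weight_iff hk2 hk12]
    simpa only [← mul_assoc, JacobiDW.polyConst_U_mul_inv, one_mul] using hcanon
  · ext D
    rw [hconj Q hQ, he.eigenAlgebra_eq, JacobiDW.conjU_mem_adjoin_iff]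
  · exact JacobiDW.finrank_gradedPiece he (hconj Q hQ)
  · rw [hdiag Q' hQ', he.eigenAlgebra_eq]
  · rw [hconj Q hQ, hdiag Q' hQ']
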